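/- Let $K$ be a field and let $G$ be a tree on the vertex set $[n]=\{1,\dots,n\}$. Let $S=K[x_1,\dots,x_n,y_1,\dots,y_n]$ and let $$J_G=(x_iy_j-x_jy_i \;:\; i<j,\ \{i,j\}\in E(G))\subseteq S$$ be the binomial edge ideal of $G$. Then $J_G$ is of linear type, i.e. the natural surjective $S$-algebra homomorphism $$\operatorname{Sym}_S(J_G)\longrightarrow \mathcal R(J_G)=\bigoplus_{i\ge 0}J_G^i\,t^i\subseteq S[t],$$ which sends $a\in J_G$ (in degree one of the symmetric algebra) to $a\,t$, is an isomorphism. -/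

import Mathlib

namespace BinomialEdge

open MvPolynomial

/-- The polynomial ring `S = K[x_1, …, x_n, y_1, …, y_n]`: the variable `x_i` is `X (Sum.inl i)`
and the variable `y_i` is `X (Sum.inr i)`. -/
abbrev PolyRing (K : Type*) [Field K] (n : ℕ) : Type _ := MvPolynomial (Fin n ⊕ Fin n) K

/-- The edge binomial `f_{ij} = x_i y_j - x_j y_i`. -/
noncomputable def edgeBinomial (K : Type*) [Field K] {n : ℕ} (i j : Fin n) : PolyRing K n :=
  X (Sum.inl i) * X (Sum.inr j) - X (Sum.inl j) * X (Sum.inr i)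

/-- The binomial edge ideal `J_G = (f_{ij} : i < j, {i, j} ∈ E(G))`. -/
noncomputable def binomialEdgeIdeal (K : Type*) [Field K] {n : ℕ} (G : SimpleGraph (Fin n)) :
    Ideal (PolyRing K n) :=
  Ideal.span {f | ∃ i j : Fin n, i < j ∧ G.Adj i j ∧ f = edgeBinomial K i j}

/-- The `A`-linear map `I → R(I)`, `a ↦ a t`, onto the degree-one part of the Rees algebra
`R(I) = ⨁ I ^ i t ^ i ⊆ A[t]`. -/
noncomputable def degreeOne {A : Type*} [CommRing A] (I : Ideal A) : I →ₗ[A] reesAlgebra I :=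
  LinearMap.codRestrict (Subalgebra.toSubmodule (reesAlgebra I))
    ((Polynomial.monomial 1 : A →ₗ[A] Polynomial A).comp (Submodule.subtype I))
    (fun a => reesAlgebra.monomial_mem.mpr (by simp))

/-- The natural `A`-algebra homomorphism `Sym(I) → R(I)`. -/
noncomputable def symToRees {A : Type*} [CommRing A] (I : Ideal A) :
    SymmetricAlgebra A I →ₐ[A] reesAlgebra I :=
  SymmetricAlgebra.lift (degreeOne I)

/-- An ideal is of linear type if the natural map from its symmetric algebra to its Rees algebra
is an isomorphism. -/
def IsOfLinearType {A : Type*} [CommRing A] (I : Ideal A) : Prop :=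
  Function.Bijective (symToRees I)

end BinomialEdge

/-!
A tree is rooted, so that it becomes a parent function `π` with a depth function, and each vertex
`i` other than the root contributes the edge binomial `f_i = det (p_{π i}, p_i)`, where
`p_i = (x_i, y_i)`. By induction on the number of edges, simultaneously over all coefficient
domains `R`, the ideal `J_E = (f_i : i ∈ E)` of every rooted forest is shown to be radical *and*
of linear type (`radicalLinearType_forestIdeal`).

The mechanism for linear type is `LinearTypeIdeal.sup_span_singleton`. If `I` is of linear type,
then `Sym (I + (a)) = R(I)[U] / (I : a) (U - a t)`. Since `U - a t` is monic in `U`, an element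
`g ≠ 0` which is a nonzerodivisor on `R(I) / (I : a) R(I)` is a nonzerodivisor on this algebra,
and so linear type of `I + (a)` can be tested after inverting `g`. When `g` is a variable, the
condition holds as soon as `I` and `I : a` do not involve that variable (`VarFree`).

Let `v` be a deepest vertex of the forest, `u` its parent, and `E'` the set of the other edges.

* `J_{E'}` does not involve `x_v, y_v`. As `J_{E'}` is radical and stable under the shear
  `x ↦ x + t y`, a multiple `c x_u ∈ J_{E'}` forces `c y_u ∈ J_{E'}` (`mul_y_mem_of_mul_x_mem`),
  and therefore `J_{E'} : f_v = J_{E'} : x_u`, which is free of `x_v`. So `x_v` may be inverted;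
  over `R[x, y][1/x_v]` a change of coordinates in `SL₂` moves `p_v` to `(1, 0)` and turns `J_E`
  into `J_{E'} + (y_u)` (`RadicalLinearType.map_localization_forestIdeal`).
* Because `v` is deepest, all children of `u` are leaves. Modulo `y_u` the binomials of the edges
  at `u` become the products `x_u y_i` for the other children `i` of `u`, and `x_u y_w` for the
  parent `w` of `u`. The remaining edges form a forest `E₀` not involving `u`, and the products
  are added one at a time by `RadicalLinearType.sup_span_X_mul`, which reduces `I + (z l)`, with
  `z` a variable, to `I` and `I + (l)`. The ideals `J_{E₀} + (y_w)` and `J_{E₀} + (x_u)` arising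
  there come from smaller forests.
-/

namespace BinomialEdge

open MvPolynomial

/-! ### Families and ideals of linear type -/

section LinearType

variable {ι κ A B : Type*} [CommRing A] [CommRing B]

/-- The ideal of `A[T_i : i ∈ ι]` generated by the linear forms `∑ c_i T_i` with `∑ c_i f_i = 0`;
the quotient by it is the symmetric algebra of the ideal generated by the `f_i`. -/
noncomputable def linearRelations (f : ι → A) : Ideal (MvPolynomial ι A) :=
  Ideal.span ((fun c => Finsupp.linearCombination A (X : ι → MvPolynomial ι A) c) ''
    {c | Finsupp.linearCombination A f c = 0})

/-- The presentation `T_i ↦ f_i t` of the Rees algebra of the ideal generated by the `f_i`. -/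
noncomputable def reesEval (f : ι → A) : MvPolynomial ι A →ₐ[A] Polynomial A :=
  aeval fun i => Polynomial.monomial 1 (f i)

/-- Every polynomial relation between the `f_i t` is a consequence of linear relations between the
`f_i`. -/
def LinearTypeFamily (f : ι → A) : Prop :=
  ∀ F, reesEval f F = 0 → F ∈ linearRelations f

lemma linearForm_mem_linearRelations {f : ι → A} {c : ι →₀ A}
    (hc : Finsupp.linearCombination A f c = 0) :
    Finsupp.linearCombination A (X : ι → MvPolynomial ι A) c ∈ linearRelations f :=
  Ideal.subset_span ⟨c, hc, rfl⟩

lemma reesEval_linearForm (f : ι → A) (c : ι →₀ A) :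
    reesEval f (Finsupp.linearCombination A X c) =
      Polynomial.monomial 1 (Finsupp.linearCombination A f c) := by
  induction c using Finsupp.induction_linear with
  | zero => simp
  | add x y hx hy => simp [hx, hy]
  | single i a => simp [reesEval, Polynomial.smul_monomial]

lemma reesEval_eq_zero_of_mem {f : ι → A} {F : MvPolynomial ι A}
    (hF : F ∈ linearRelations f) : reesEval f F = 0 := by
  have : linearRelations f ≤ RingHom.ker (reesEval f).toRingHom := by
    refine Ideal.span_le.2 ?_
    rintro _ ⟨c, hc, rfl⟩
    have hc' : Finsupp.linearCombination A f c = 0 := hc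
    show reesEval f _ = 0
    rw [reesEval_linearForm, hc', map_zero]
  exact this hF

/-- The ring homomorphism which is `α` on coefficients and sends `T_i` to the linear form with
coefficients `c i`. -/
noncomputable def substLinear (α : A →+* B) (c : ι → κ →₀ B) :
    MvPolynomial ι A →+* MvPolynomial κ B :=
  eval₂Hom (C.comp α) fun i => Finsupp.linearCombination B X (c i)

lemma substLinear_linearForm (α : A →+* B) (c : ι → κ →₀ B) (e : ι →₀ A) :
    substLinear α c (Finsupp.linearCombination A X e) =
      Finsupp.linearCombination B X (e.sum fun i a => α a • c i) := by
  induction e using Finsupp.induction_linear with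
  | zero => simp
  | add x y hx hy =>
    rw [Finsupp.sum_add_index' (by simp) (by simp [add_smul])]
    simp [hx, hy]
  | single i a => simp [substLinear, MvPolynomial.smul_eq_C_mul]

lemma linearCombination_subst {f : ι → A} {g : κ → B} (α : A →+* B) {c : ι → κ →₀ B}
    (hc : ∀ i, Finsupp.linearCombination B g (c i) = α (f i)) (e : ι →₀ A) :
    Finsupp.linearCombination B g (e.sum fun i a => α a • c i) =
      α (Finsupp.linearCombination A f e) := by
  induction e using Finsupp.induction_linear with
  | zero => simp
  | add x y hx hy =>
    rw [Finsupp.sum_add_index' (by simp) (by simp [add_smul])]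
    simp [hx, hy]
  | single i a => simp [hc]

lemma substLinear_mem {f : ι → A} {g : κ → B} (α : A →+* B) {c : ι → κ →₀ B}
    (hc : ∀ i, Finsupp.linearCombination B g (c i) = α (f i)) {F : MvPolynomial ι A}
    (hF : F ∈ linearRelations f) : substLinear α c F ∈ linearRelations g := by
  have : linearRelations f ≤ (linearRelations g).comap (substLinear α c) := by
    refine Ideal.span_le.2 ?_
    rintro _ ⟨e, he, rfl⟩
    have he' : Finsupp.linearCombination A f e = 0 := he
    show substLinear α c _ ∈ linearRelations g
    rw [substLinear_linearForm]
    apply linearForm_mem_linearRelations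
    rw [linearCombination_subst α hc, he', map_zero]
  exact this hF

lemma reesEval_substLinear {f : ι → A} {g : κ → B} (α : A →+* B) {c : ι → κ →₀ B}
    (hc : ∀ i, Finsupp.linearCombination B g (c i) = α (f i)) (F : MvPolynomial ι A) :
    reesEval g (substLinear α c F) = (reesEval f F).map α := by
  have : ((reesEval g : _ →+* _).comp (substLinear α c)) =
      (Polynomial.mapRingHom α).comp (reesEval f : MvPolynomial ι A →+* Polynomial A) := by
    apply MvPolynomial.ringHom_ext
    · intro a
      have h1 : reesEval g (C (α a)) = Polynomial.C (α a) := (reesEval g).commutes (α a)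
      have h2 : reesEval f (C a) = Polynomial.C a := (reesEval f).commutes a
      simp only [substLinear, RingHom.comp_apply, coe_eval₂Hom, eval₂_C, RingHom.coe_coe, h1, h2,
        Polynomial.coe_mapRingHom, Polynomial.map_C]
    · intro i
      simp only [substLinear, RingHom.comp_apply, coe_eval₂Hom, eval₂_X, RingHom.coe_coe,
        reesEval_linearForm, hc]
      simp [reesEval]
  exact RingHom.congr_fun this F

/-- Linear type passes to retracts: this contains independence of the chosen generators (`α` and
`β` the identity), invariance under isomorphisms, and descent along split extensions. -/
theorem LinearTypeFamily.transfer {f : ι → A} {g : κ → B} (hg : LinearTypeFamily g)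
    (α : A →+* B) (β : B →+* A)
    (hβα : ∀ a, β (α a) = a) (hα : ∀ i, α (f i) ∈ Ideal.span (Set.range g))
    (hβ : ∀ k, β (g k) ∈ Ideal.span (Set.range f)) : LinearTypeFamily f := by
  have hα' : ∀ i, ∃ c : κ →₀ B, Finsupp.linearCombination B g c = α (f i) := fun i =>
    (Finsupp.mem_ideal_span_range_iff_exists_finsupp.1 (hα i)).imp fun c hc => by
      simpa [Finsupp.linearCombination_apply] using hc
  have hβ' : ∀ k, ∃ c : ι →₀ A, Finsupp.linearCombination A f c = β (g k) := fun i =>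
    (Finsupp.mem_ideal_span_range_iff_exists_finsupp.1 (hβ i)).imp fun c hc => by
      simpa [Finsupp.linearCombination_apply] using hc
  choose c hc using hα'
  choose d hd using hβ'
  intro F hF
  have h1 : substLinear β d (substLinear α c F) ∈ linearRelations f := by
    refine substLinear_mem β hd (hg _ ?_)
    rw [reesEval_substLinear α hc, hF, Polynomial.map_zero]
  have h2 : (Ideal.Quotient.mk (linearRelations f)).comp
      ((substLinear β d).comp (substLinear α c)) = Ideal.Quotient.mk (linearRelations f) := by
    apply MvPolynomial.ringHom_ext
    · intro a; simp [substLinear, hβα]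
    · intro i
      simp only [RingHom.comp_apply]
      rw [show substLinear α c (X i) = Finsupp.linearCombination B X (c i) by simp [substLinear],
        substLinear_linearForm, ← sub_eq_zero, ← map_sub, Ideal.Quotient.eq_zero_iff_mem,
        show (X i : MvPolynomial ι A) = Finsupp.linearCombination A X (Finsupp.single i 1) by simp,
        ← map_sub]
      apply linearForm_mem_linearRelations
      rw [map_sub, linearCombination_subst β hd, hc, hβα]
      simp
  have h3 := RingHom.congr_fun h2 F
  simp only [RingHom.comp_apply] at h3
  rw [Ideal.Quotient.eq_zero_iff_mem.2 h1] at h3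
  exact Ideal.Quotient.eq_zero_iff_mem.1 h3.symm

theorem LinearTypeFamily.of_span_eq {f : ι → A} {g : κ → A} (hg : LinearTypeFamily g)
    (h : Ideal.span (Set.range f) = Ideal.span (Set.range g)) : LinearTypeFamily f :=
  hg.transfer (RingHom.id A) (RingHom.id A) (fun _ => rfl)
    (fun i => h ▸ Ideal.subset_span ⟨i, rfl⟩) (fun i => h ▸ Ideal.subset_span ⟨i, rfl⟩)

/-- Linear type of an ideal, expressed for the family of all its elements. By
`linearTypeIdeal_iff_of_span` any generating family may be used instead. -/
def LinearTypeIdeal (I : Ideal A) : Prop := LinearTypeFamily (Subtype.val : I → A)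

lemma linearTypeIdeal_iff_of_span {f : ι → A} {I : Ideal A} (h : Ideal.span (Set.range f) = I) :
    LinearTypeIdeal I ↔ LinearTypeFamily f := by
  have h' : Ideal.span (Set.range (Subtype.val : I → A)) = I := by simp
  exact ⟨fun hI => LinearTypeFamily.of_span_eq hI (h.trans h'.symm),
    fun hf => LinearTypeFamily.of_span_eq hf (h'.trans h.symm)⟩

lemma linearTypeIdeal_top : LinearTypeIdeal (⊤ : Ideal A) := by
  rw [linearTypeIdeal_iff_of_span (f := fun _ : Unit => (1 : A)) (by simp)]
  intro F hF
  have : reesEval (fun _ : Unit => (1 : A)) = (MvPolynomial.uniqueAlgEquiv A Unit : _ →ₐ[A] _) := by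
    ext i
    simp [reesEval, Polynomial.monomial_one_one_eq_X]
  rw [this] at hF
  rw [(MvPolynomial.uniqueAlgEquiv A Unit).map_eq_zero_iff.1 hF]
  exact zero_mem _

lemma linearTypeIdeal_bot : LinearTypeIdeal (⊥ : Ideal A) := by
  rw [linearTypeIdeal_iff_of_span (f := fun i : Empty => (i.elim : A)) (by simp)]
  intro F hF
  obtain ⟨a, rfl⟩ := MvPolynomial.C_surjective Empty F
  have : a = 0 := by simpa [reesEval] using hF
  simp [this]

end LinearType

/-! ### Localization at one element -/

section Localization

variable {ι A : Type*} [CommRing A]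

attribute [local instance] MvPolynomial.algebraMvPolynomial

lemma substLinear_single {B : Type*} [CommRing B] (α : A →+* B) :
    substLinear α (fun i : ι => Finsupp.single i (1 : B)) = MvPolynomial.map α := by
  apply MvPolynomial.ringHom_ext <;> intro i <;> simp [substLinear]

variable [IsDomain A]

/-- Clearing denominators: linear relations over `A[1/g]` come from linear relations over `A`. -/
lemma linearRelations_le_map_localization {g : A} (hg : g ≠ 0) (f : ι → A) :
    linearRelations (fun i => algebraMap A (Localization.Away g) (f i)) ≤
      (linearRelations f).map
        (algebraMap (MvPolynomial ι A) (MvPolynomial ι (Localization.Away g))) := by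
  set Ag := Localization.Away g with hAg
  have hinj : Function.Injective (algebraMap A Ag) :=
    IsLocalization.injective Ag (powers_le_nonZeroDivisors_of_noZeroDivisors hg)
  refine Ideal.span_le.2 ?_
  rintro _ ⟨c, hc, rfl⟩
  have hc' : Finsupp.linearCombination Ag (fun i => algebraMap A Ag (f i)) c = 0 := hc
  obtain ⟨b, hb⟩ := IsLocalization.exist_integer_multiples (Submonoid.powers g) c.support c
  have hb' : ∀ i, ∃ e : A, algebraMap A Ag e = algebraMap A Ag b * c i := by
    intro i
    by_cases hi : i ∈ c.support
    · obtain ⟨e, he⟩ := hb i hi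
      exact ⟨e, by rw [he, Algebra.smul_def]⟩
    · exact ⟨0, by simp [Finsupp.notMem_support_iff.1 hi]⟩
  choose e he using hb'
  let c' : ι →₀ A := Finsupp.onFinset c.support e fun i hi => by
    rw [Finsupp.mem_support_iff]
    intro h0
    apply hi
    apply hinj
    rw [he, h0, mul_zero, map_zero]
  have hsum : (c'.sum fun i a => algebraMap A Ag a • Finsupp.single i (1 : Ag)) =
      algebraMap A Ag b • c := by
    have h1 : c'.mapRange (algebraMap A Ag) (map_zero _) = algebraMap A Ag b • c := by
      ext i
      simp [c', he, Algebra.smul_def]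
      exact Or.inl rfl
    rw [← h1]
    conv_rhs => rw [← Finsupp.sum_single (c'.mapRange (algebraMap A Ag) (map_zero _))]
    rw [Finsupp.sum_mapRange_index (by simp)]
    simp [Algebra.smul_def]
  have hrel : Finsupp.linearCombination A f c' = 0 := by
    apply hinj
    rw [← linearCombination_subst (g := fun i => algebraMap A Ag (f i)) (algebraMap A Ag)
      (c := fun i => Finsupp.single i 1) (by simp), hsum, map_smul, hc', smul_zero, map_zero]
  have hmem := Ideal.mem_map_of_mem
    (algebraMap (MvPolynomial ι A) (MvPolynomial ι Ag)) (linearForm_mem_linearRelations hrel)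
  rw [MvPolynomial.algebraMap_def, ← substLinear_single, substLinear_linearForm, hsum,
    substLinear_single, ← MvPolynomial.algebraMap_def, map_smul, MvPolynomial.smul_eq_C_mul] at hmem
  refine (Ideal.unit_mul_mem_iff_mem _ ?_).1 hmem
  exact (IsLocalization.map_units Ag b).map C

theorem LinearTypeFamily.of_localization {g : A} (hg : g ≠ 0) {f : ι → A}
    (h : LinearTypeFamily (fun i => algebraMap A (Localization.Away g) (f i)))
    {F : MvPolynomial ι A} (hF : reesEval f F = 0) :
    ∃ N : ℕ, C (g ^ N) * F ∈ linearRelations f := by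
  have h1 : MvPolynomial.map (algebraMap A (Localization.Away g)) F ∈
      linearRelations (fun i => algebraMap A (Localization.Away g) (f i)) := by
    apply h
    have := reesEval_substLinear (f := f) (g := fun i => algebraMap A (Localization.Away g) (f i))
      (algebraMap A (Localization.Away g)) (c := fun i => Finsupp.single i 1) (by simp) F
    rw [hF, Polynomial.map_zero] at this
    rwa [substLinear_single] at this
  have h2 := linearRelations_le_map_localization hg f h1
  have h3 := (IsLocalization.algebraMap_mem_map_algebraMap_iff
    ((Submonoid.powers g).map (C (σ := ι))) (MvPolynomial ι (Localization.Away g))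
    (linearRelations f) F).1 h2
  obtain ⟨_, ⟨_, ⟨N, rfl⟩, rfl⟩, h⟩ := h3
  exact ⟨N, h⟩

lemma LinearTypeIdeal.map_localization {I : Ideal A} (hI : LinearTypeIdeal I) {g : A} (hg : g ≠ 0) :
    LinearTypeIdeal (I.map (algebraMap A (Localization.Away g))) := by
  set Ag := Localization.Away g with hAg
  rw [linearTypeIdeal_iff_of_span (f := fun a : I => algebraMap A Ag a)
    (by rw [Set.range_comp' (algebraMap A Ag), ← Ideal.map_span]; simp; rfl)]
  intro F hF
  have hinj : Function.Injective (algebraMap A Ag) :=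
    IsLocalization.injective Ag (powers_le_nonZeroDivisors_of_noZeroDivisors hg)
  obtain ⟨⟨F', ⟨_, b, hb, rfl⟩⟩, hF'⟩ := IsLocalization.surj
    ((Submonoid.powers g).map (C (σ := I))) F
  have key := reesEval_substLinear (f := (Subtype.val : I → A))
      (g := fun i : I => algebraMap A Ag i) (algebraMap A Ag)
      (c := fun i => Finsupp.single i 1) (by simp)
  rw [substLinear_single] at key
  have hrel : F' ∈ linearRelations (Subtype.val : I → A) := by
    apply hI
    apply Polynomial.map_injective _ hinj
    rw [← key, ← MvPolynomial.algebraMap_def, ← hF', map_mul, hF, zero_mul, Polynomial.map_zero]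
  have hmem := substLinear_mem (g := fun i : I => algebraMap A Ag i) (algebraMap A Ag)
      (c := fun i => Finsupp.single i 1) (by simp) hrel
  rw [substLinear_single, ← MvPolynomial.algebraMap_def, ← hF'] at hmem
  refine (Ideal.mul_unit_mem_iff_mem _ ?_).1 hmem
  exact IsLocalization.map_units _ (⟨C b, b, hb, rfl⟩ : (Submonoid.powers g).map (C (σ := I)))

end Localization

/-! ### Adding one generator to an ideal of linear type -/

section OneStep

variable {ι A : Type*} [CommRing A]

/-- The polynomial `p ∈ A[t]` lies in `𝔠 R(I) = ⨁ 𝔠 I ^ k t ^ k`, the extension of the ideal `𝔠`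
to the Rees algebra `R(I)`. -/
def CoeffsIn (𝔠 I : Ideal A) (p : Polynomial A) : Prop := ∀ k, p.coeff k ∈ 𝔠 * I ^ k

lemma CoeffsIn.mul_rees {𝔠 I : Ideal A} {p q : Polynomial A} (hp : CoeffsIn 𝔠 I p)
    (hq : q ∈ reesAlgebra I) : CoeffsIn 𝔠 I (p * q) := by
  intro k
  rw [Polynomial.coeff_mul]
  refine sum_mem fun x hx => ?_
  rw [← Finset.HasAntidiagonal.mem_antidiagonal.1 hx, pow_add, ← mul_assoc]
  exact Ideal.mul_mem_mul (hp _) (hq _)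

lemma CoeffsIn.add {𝔠 I : Ideal A} {p q : Polynomial A} (hp : CoeffsIn 𝔠 I p)
    (hq : CoeffsIn 𝔠 I q) : CoeffsIn 𝔠 I (p + q) := fun k => by
  rw [Polynomial.coeff_add]; exact add_mem (hp k) (hq k)

lemma coeffsIn_zero {𝔠 I : Ideal A} : CoeffsIn 𝔠 I 0 := fun k => by simp

lemma CoeffsIn.sum {𝔠 I : Ideal A} {α : Type*} {s : Finset α} {p : α → Polynomial A}
    (hp : ∀ i ∈ s, CoeffsIn 𝔠 I (p i)) : CoeffsIn 𝔠 I (∑ i ∈ s, p i) := fun k => by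
  rw [Polynomial.finsetSum_coeff]; exact sum_mem fun i hi => hp i hi k

lemma range_reesEval (f : ι → A) :
    (reesEval f).range = reesAlgebra (Ideal.span (Set.range f)) := by
  rw [← adjoin_monomial_eq_reesAlgebra, reesEval, ← Algebra.adjoin_range_eq_range_aeval]
  apply le_antisymm
  · apply Algebra.adjoin_mono
    rintro _ ⟨i, rfl⟩
    exact ⟨f i, Ideal.subset_span ⟨i, rfl⟩, rfl⟩
  · apply Algebra.adjoin_le
    rintro _ ⟨x, hx, rfl⟩
    have : Submodule.map (Polynomial.monomial 1 : A →ₗ[A] Polynomial A)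
        (Submodule.span A (Set.range f)) ≤
        Subalgebra.toSubmodule
          (Algebra.adjoin A (Set.range fun i => Polynomial.monomial 1 (f i))) := by
      rw [Submodule.map_span, Submodule.span_le]
      rintro _ ⟨_, ⟨i, rfl⟩, rfl⟩
      exact Algebra.subset_adjoin ⟨i, rfl⟩
    exact this ⟨x, hx, rfl⟩

lemma reesEval_mem (f : ι → A) (F : MvPolynomial ι A) :
    reesEval f F ∈ reesAlgebra (Ideal.span (Set.range f)) := by
  rw [← range_reesEval]; exact ⟨F, rfl⟩

lemma CoeffsIn.exists_lift {f : ι → A} {𝔠 : Ideal A} {p : Polynomial A}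
    (hp : CoeffsIn 𝔠 (Ideal.span (Set.range f)) p) :
    ∃ m ∈ 𝔠.map (C : A →+* MvPolynomial ι A), reesEval f m = p := by
  set I := Ideal.span (Set.range f)
  have key : ∀ k, ∀ x ∈ 𝔠 * I ^ k, ∃ m ∈ 𝔠.map (C : A →+* MvPolynomial ι A),
      reesEval f m = Polynomial.monomial k x := by
    intro k x hx
    refine Submodule.mul_induction_on hx ?_ ?_
    · intro γ hγ y hy
      have hy' : Polynomial.monomial k y ∈ (reesEval f).range := by
        rw [range_reesEval]; exact reesAlgebra.monomial_mem.2 hy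
      obtain ⟨m, hm⟩ := hy'
      have hm' : reesEval f m = Polynomial.monomial k y := hm
      refine ⟨C γ * m, Ideal.mul_mem_right _ _ (Ideal.mem_map_of_mem _ hγ), ?_⟩
      rw [map_mul, hm', ← MvPolynomial.algebraMap_eq, AlgHom.commutes]
      simp [Polynomial.C_mul_monomial]
    · rintro x y ⟨m, hm, hmx⟩ ⟨m', hm', hmy⟩
      exact ⟨m + m', add_mem hm hm', by rw [map_add, map_add, hmx, hmy]⟩
  choose m hm hmx using fun k => key k _ (hp k)
  refine ⟨∑ k ∈ p.support, m k, sum_mem fun k _ => hm k, ?_⟩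
  rw [map_sum, Finset.sum_congr rfl fun k _ => hmx k]
  exact p.as_sum_support.symm

variable (f : ι → A) (a : A)

/-- The family `f` together with one more element `a`, at the index `none`. -/
def optionFamily : Option ι → A := fun o => o.elim a f

lemma span_range_optionFamily :
    Ideal.span (Set.range (optionFamily f a)) = Ideal.span (Set.range f) ⊔ Ideal.span {a} := by
  have : Set.range (optionFamily f a) = Set.range f ∪ {a} := by
    ext x; simp [optionFamily, Option.exists, eq_comm]
  rw [this, Ideal.span_union]

/-- `Q` lies in `𝔠 R(I)[U] (U - a t) ⊆ A[t][U]`. For `𝔠 = I : a` this is the image in `R(I)[U]` of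
the ideal of linear relations of a generating family of `I` extended by `a`. -/
def RelImage (𝔠 I : Ideal A) (Q : Polynomial (Polynomial A)) : Prop :=
  ∃ s : Polynomial (Polynomial A), (∀ j, CoeffsIn 𝔠 I (s.coeff j)) ∧
    Q = s * (Polynomial.X - Polynomial.C (Polynomial.monomial 1 a))

variable {f a}

lemma RelImage.add {𝔠 I : Ideal A} {P Q : Polynomial (Polynomial A)} (hP : RelImage a 𝔠 I P)
    (hQ : RelImage a 𝔠 I Q) : RelImage a 𝔠 I (P + Q) := by
  obtain ⟨s, hs, rfl⟩ := hP
  obtain ⟨s', hs', rfl⟩ := hQ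
  exact ⟨s + s', fun j => by rw [Polynomial.coeff_add]; exact (hs j).add (hs' j), by ring⟩

lemma RelImage.mul_rees {𝔠 I : Ideal A} {P W : Polynomial (Polynomial A)} (hP : RelImage a 𝔠 I P)
    (hW : ∀ j, W.coeff j ∈ reesAlgebra I) : RelImage a 𝔠 I (P * W) := by
  obtain ⟨s, hs, rfl⟩ := hP
  refine ⟨s * W, fun j => ?_, by ring⟩
  rw [Polynomial.coeff_mul]
  exact CoeffsIn.sum fun x _ => (hs _).mul_rees (hW _)

/-- The homomorphism `A[T_o : o ∈ Option ι] → A[t][U]` with `T_i ↦ f_i t` and `T_none ↦ U`. -/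
noncomputable def partialEval (f : ι → A) :
    MvPolynomial (Option ι) A →+* Polynomial (Polynomial A) :=
  (Polynomial.mapRingHom (reesEval f : MvPolynomial ι A →+* Polynomial A)).comp
    (optionEquivLeft A ι : MvPolynomial (Option ι) A →+* Polynomial (MvPolynomial ι A))

lemma partialEval_C (γ : A) :
    partialEval f (C γ) = Polynomial.C (Polynomial.C γ) := by
  have h2 : reesEval f (C γ) = Polynomial.C γ := (reesEval f).commutes γ
  simp [partialEval, h2]

lemma partialEval_X_none : partialEval f (X none) = Polynomial.X := by
  simp [partialEval]

lemma partialEval_X_some (i : ι) :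
    partialEval f (X (some i)) = Polynomial.C (Polynomial.monomial 1 (f i)) := by
  simp [partialEval, reesEval]

lemma partialEval_linearForm (c : Option ι →₀ A) :
    partialEval f (Finsupp.linearCombination A X c) =
      Polynomial.C (Polynomial.C (c none)) *
        (Polynomial.X - Polynomial.C (Polynomial.monomial 1 a)) +
      Polynomial.C (Polynomial.monomial 1 (Finsupp.linearCombination A (optionFamily f a) c)) := by
  induction c using Finsupp.induction_linear with
  | zero => simp
  | add x y hx hy => simp only [map_add, hx, hy, Finsupp.add_apply]; ring
  | single o r =>
    rw [Finsupp.linearCombination_single, MvPolynomial.smul_eq_C_mul, map_mul, partialEval_C,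
      Finsupp.linearCombination_single]
    cases o with
    | none =>
      rw [partialEval_X_none]
      simp [optionFamily, mul_sub, ← Polynomial.C_mul, Polynomial.C_mul_monomial]
    | some i =>
      rw [partialEval_X_some]
      simp [optionFamily, ← Polynomial.C_mul, Polynomial.C_mul_monomial]

lemma relImage_partialEval {𝔠 : Ideal A}
    (h𝔠 : ∀ γ, γ * a ∈ Ideal.span (Set.range f) → γ ∈ 𝔠) {F : MvPolynomial (Option ι) A}
    (hF : F ∈ linearRelations (optionFamily f a)) :
    RelImage a 𝔠 (Ideal.span (Set.range f)) (partialEval f F) := by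
  refine Submodule.span_induction (p := fun F _ =>
    RelImage a 𝔠 (Ideal.span (Set.range f)) (partialEval f F)) ?_ ?_ ?_ ?_ hF
  · rintro _ ⟨c, hc, rfl⟩
    have hc' : Finsupp.linearCombination A (optionFamily f a) c = 0 := hc
    show RelImage _ _ _ (partialEval f (Finsupp.linearCombination A X c))
    rw [partialEval_linearForm (a := a), hc']
    refine ⟨Polynomial.C (Polynomial.C (c none)), ?_, by simp⟩
    have hγ : c none ∈ 𝔠 := by
      apply h𝔠
      have h1 : Finsupp.linearCombination A (optionFamily f a) c =
          c none * a + Finsupp.linearCombination A f c.some := by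
        rw [Finsupp.linearCombination_option]
        rfl
      rw [h1] at hc'
      rw [eq_neg_of_add_eq_zero_left hc']
      refine neg_mem ?_
      rw [Ideal.span, ← Finsupp.range_linearCombination]
      exact ⟨_, rfl⟩
    intro j k
    rw [Polynomial.coeff_C]
    split_ifs
    · rw [Polynomial.coeff_C]
      split_ifs with h
      · subst h; simpa using hγ
      · exact zero_mem _
    · exact zero_mem _
  · rw [map_zero]
    exact ⟨0, fun j => by rw [Polynomial.coeff_zero]; exact coeffsIn_zero, by simp⟩
  · intro x y _ _ hx hy
    rw [map_add]; exact hx.add hy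
  · intro b x _ hx
    rw [smul_eq_mul, map_mul, mul_comm]
    refine hx.mul_rees fun j => ?_
    simp only [partialEval, RingHom.comp_apply, Polynomial.coe_mapRingHom, Polynomial.coeff_map]
    exact reesEval_mem f _

lemma optionEquivLeft_symm_C_mem {m : MvPolynomial ι A} (hm : m ∈ linearRelations f) :
    (optionEquivLeft A ι).symm (Polynomial.C m) ∈ linearRelations (optionFamily f a) := by
  have h := substLinear_mem (g := optionFamily f a) (RingHom.id A)
    (c := fun i => Finsupp.single (some i) 1) (by simp [optionFamily]) hm
  convert h using 1
  have : ((optionEquivLeft A ι).symm : _ →+* MvPolynomial (Option ι) A).comp Polynomial.C =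
      substLinear (RingHom.id A) (fun i : ι => Finsupp.single (some i) (1 : A)) := by
    apply MvPolynomial.ringHom_ext <;> intro i <;> simp [substLinear]
  exact RingHom.congr_fun this m

/-- For `γ ∈ I : a` with `γ a = ∑ c_i f_i`, the form `γ T_none - ∑ c_i T_i` is a linear relation.
By linearity every element of the extension of `I : a` is the leading coefficient of a relation of
degree one in `T_none`. -/
lemma exists_lift_relation {𝔠 : Ideal A}
    (h𝔠 : ∀ γ ∈ 𝔠, γ * a ∈ Ideal.span (Set.range f)) {m : MvPolynomial ι A}
    (hm : m ∈ 𝔠.map (C : A →+* MvPolynomial ι A)) :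
    ∃ m' : MvPolynomial ι A, (optionEquivLeft A ι).symm
        (Polynomial.C m * Polynomial.X - Polynomial.C m') ∈ linearRelations (optionFamily f a) ∧
      reesEval f m' = reesEval f m * Polynomial.monomial 1 a := by
  refine Submodule.span_induction (p := fun m _ => ∃ m' : MvPolynomial ι A,
    (optionEquivLeft A ι).symm
        (Polynomial.C m * Polynomial.X - Polynomial.C m') ∈ linearRelations (optionFamily f a) ∧
      reesEval f m' = reesEval f m * Polynomial.monomial 1 a) ?_ ?_ ?_ ?_ hm
  · rintro _ ⟨γ, hγ, rfl⟩
    obtain ⟨c, hc⟩ := Finsupp.mem_ideal_span_range_iff_exists_finsupp.1 (h𝔠 γ hγ)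
    have hc : Finsupp.linearCombination A f c = γ * a := by
      simpa [Finsupp.linearCombination_apply] using hc
    refine ⟨Finsupp.linearCombination A X c, ?_, ?_⟩
    · have hrel : Finsupp.linearCombination A (optionFamily f a)
          (Finsupp.single none γ - c.mapDomain some) = 0 := by
        rw [map_sub, Finsupp.linearCombination_mapDomain]
        have : optionFamily f a ∘ some = f := rfl
        rw [this, hc]
        simp [optionFamily]
      convert linearForm_mem_linearRelations hrel using 1
      rw [map_sub, map_sub, Finsupp.linearCombination_mapDomain]
      congr 1
      · simp [MvPolynomial.smul_eq_C_mul]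
      · rw [Finsupp.linearCombination_apply, Finsupp.linearCombination_apply]
        simp only [Finsupp.sum, map_sum, MvPolynomial.smul_eq_C_mul, map_mul, Function.comp]
        simp
    · rw [reesEval_linearForm, hc]
      have h2 : reesEval f (C γ) = Polynomial.C γ := (reesEval f).commutes γ
      rw [h2, Polynomial.C_mul_monomial]
  · exact ⟨0, by simp, by simp⟩
  · rintro x y _ _ ⟨x', hx, hx'⟩ ⟨y', hy, hy'⟩
    refine ⟨x' + y', ?_, by simp only [map_add, hx', hy', add_mul]⟩
    convert add_mem hx hy using 1
    rw [← map_add]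
    congr 1
    simp only [map_add]
    ring
  · rintro b x _ ⟨x', hx, hx'⟩
    refine ⟨b * x', ?_, by simp only [smul_eq_mul, map_mul, hx', mul_assoc]⟩
    convert Ideal.mul_mem_left _ ((optionEquivLeft A ι).symm (Polynomial.C b)) hx using 1
    rw [← map_mul]
    congr 1
    simp only [map_mul, smul_eq_mul]
    ring

variable [IsDomain A]

/-- If `g ^ N` times the image of `W` in `R(I)[U]` lies in `𝔠 R(I)[U] (U - a t)`, then `W` is a
consequence of linear relations. The leading coefficient of `W` has image in `𝔠 R(I)` since `g` is
a nonzerodivisor modulo `𝔠 R(I)`, hence it is cancelled by a multiple of a linear relation. -/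
lemma RelImage.mem_linearRelations (hf : LinearTypeFamily f) {g : A} {N : ℕ} {𝔠 : Ideal A}
    (h𝔠 : ∀ γ ∈ 𝔠, γ * a ∈ Ideal.span (Set.range f))
    (hnzd : ∀ k c, g ^ N * c ∈ 𝔠 * Ideal.span (Set.range f) ^ k →
      c ∈ 𝔠 * Ideal.span (Set.range f) ^ k) (hg : g ≠ 0) (d : ℕ) :
    ∀ W : Polynomial (MvPolynomial ι A), W.degree < d →
      RelImage a 𝔠 (Ideal.span (Set.range f)) (Polynomial.C (Polynomial.C (g ^ N)) *
        W.map (reesEval f : MvPolynomial ι A →+* Polynomial A)) →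
      (optionEquivLeft A ι).symm W ∈ linearRelations (optionFamily f a) := by
  induction d with
  | zero =>
    intro W hW _
    have : W = 0 := by
      rw [← Polynomial.degree_eq_bot]
      simpa [Polynomial.degree_lt_iff_coeff_zero] using hW
    simp [this]
  | succ d ih =>
    intro W hW hrel
    set I := Ideal.span (Set.range f) with hI
    set ev := (reesEval f : MvPolynomial ι A →+* Polynomial A) with hev
    obtain ⟨s, hs, hsW⟩ := hrel
    set w := W.coeff d with hw
    have hgN : (Polynomial.C (g ^ N) : Polynomial A) ≠ 0 := by
      simpa using pow_ne_zero N hg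
    have hsdeg : ∀ j, d ≤ j → s.coeff j = 0 := by
      rw [← Polynomial.degree_lt_iff_coeff_zero]
      by_cases hs0 : s = 0
      · rw [hs0, Polynomial.degree_zero]; exact WithBot.bot_lt_coe d
      have h1 : (s * (Polynomial.X - Polynomial.C (Polynomial.monomial 1 a))).degree
          < ((d + 1 : ℕ) : WithBot ℕ) := by
        rw [← hsW]
        rw [Polynomial.degree_C_mul hgN]
        exact lt_of_le_of_lt Polynomial.degree_map_le hW
      rw [Polynomial.degree_mul, Polynomial.degree_X_sub_C,
        Polynomial.degree_eq_natDegree hs0] at h1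
      rw [Polynomial.degree_eq_natDegree hs0]
      norm_cast at h1 ⊢
      omega
    have hcoeff : ∀ j, Polynomial.C (g ^ N) * ev (W.coeff (j + 1)) =
        s.coeff j - s.coeff (j + 1) * Polynomial.monomial 1 a := by
      intro j
      have := congrArg (fun p => Polynomial.coeff p (j + 1)) hsW
      rw [Polynomial.coeff_C_mul, Polynomial.coeff_map] at this
      rw [this]
      simp [mul_sub]
    have hcoeff0 : Polynomial.C (g ^ N) * ev (W.coeff 0) =
        - (s.coeff 0 * Polynomial.monomial 1 a) := by
      have := congrArg (fun p => Polynomial.coeff p 0) hsW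
      rw [Polynomial.coeff_C_mul, Polynomial.coeff_map] at this
      rw [this]
      simp [mul_sub]
    -- It suffices to find a consequence `V` of linear relations with the same leading term as `W`.
    suffices h : ∃ V : Polynomial (MvPolynomial ι A), (W - V).degree < d ∧
        RelImage a 𝔠 I (Polynomial.C (Polynomial.C (g ^ N)) * (-V).map ev) ∧
        (optionEquivLeft A ι).symm V ∈ linearRelations (optionFamily f a) by
      obtain ⟨V, hV, hVrel, hVmem⟩ := h
      have := ih (W - V) hV (by
        have := RelImage.add ⟨s, hs, hsW⟩ hVrel
        rwa [← mul_add, ← Polynomial.map_add, ← sub_eq_add_neg] at this)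
      have h2 := add_mem this hVmem
      rwa [← map_add, sub_add_cancel] at h2
    have hdrop : ∀ V : Polynomial (MvPolynomial ι A), V.coeff d = w → V.degree < (d + 1 : ℕ) →
        (W - V).degree < d := by
      intro V h1 h2
      rw [Polynomial.degree_lt_iff_coeff_zero] at h2 hW ⊢
      intro j hj
      rw [Polynomial.coeff_sub]
      rcases hj.eq_or_lt with rfl | hj
      · rw [h1, sub_self]
      · rw [hW j hj, h2 j hj, sub_self]
    cases d with
    | zero =>
      have hw0 : ev w = 0 := by
        rw [hsdeg 0 le_rfl, zero_mul, neg_zero] at hcoeff0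
        exact (mul_eq_zero.1 hcoeff0).resolve_left hgN
      refine ⟨Polynomial.C w, hdrop _ (by simp) ?_, ?_, optionEquivLeft_symm_C_mem (hf w hw0)⟩
      · exact lt_of_le_of_lt Polynomial.degree_C_le (by norm_num)
      · rw [Polynomial.map_neg, Polynomial.map_C, hw0]
        exact ⟨0, fun j => by rw [Polynomial.coeff_zero]; exact coeffsIn_zero, by simp⟩
    | succ d =>
      have hwc : CoeffsIn 𝔠 I (ev w) := by
        intro k
        apply hnzd
        rw [← Polynomial.coeff_C_mul, hcoeff d, hsdeg (d + 1) le_rfl, zero_mul, sub_zero]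
        exact hs d k
      obtain ⟨m, hm, hmw⟩ := hwc.exists_lift
      obtain ⟨m', hm', hmm'⟩ := exists_lift_relation (a := a) h𝔠 hm
      have hker : w - m ∈ linearRelations f := hf _ (by rw [map_sub, hmw, hev]; simp)
      refine ⟨(Polynomial.C m * Polynomial.X - Polynomial.C m') * Polynomial.X ^ d +
        Polynomial.C (w - m) * Polynomial.X ^ (d + 1), hdrop _ ?_ ?_, ?_, ?_⟩
      · simp [sub_mul, mul_assoc, ← pow_succ', Polynomial.coeff_X_pow]
      · rw [Polynomial.degree_lt_iff_coeff_zero]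
        intro j hj
        have h1 : j ≠ d := by omega
        have h2 : j ≠ d + 1 := by omega
        simp [sub_mul, mul_assoc, ← pow_succ', Polynomial.coeff_X_pow, h1, h2]
      · have h0 : ev (w - m) = 0 := reesEval_eq_zero_of_mem hker
        have h1 : ev m' = ev m * Polynomial.monomial 1 a := hmm'
        have h2 : ev m = ev w := hmw
        refine ⟨Polynomial.C (-(Polynomial.C (g ^ N) * ev w)) * Polynomial.X ^ d, ?_, ?_⟩
        · intro j
          rw [Polynomial.coeff_C_mul, Polynomial.coeff_X_pow]
          split_ifs
          · rw [mul_one]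
            intro k
            rw [Polynomial.coeff_neg, Polynomial.coeff_C_mul]
            exact neg_mem (Ideal.mul_mem_left _ _ (hwc k))
          · rw [mul_zero]; exact coeffsIn_zero
        · simp only [Polynomial.map_neg, Polynomial.map_add, Polynomial.map_sub, Polynomial.map_mul,
            Polynomial.map_pow, Polynomial.map_C, Polynomial.map_X, h0, h1, h2, map_zero, map_neg,
            map_mul]
          ring
      · rw [map_add]
        refine add_mem ?_ ?_
        · rw [map_mul]; exact Ideal.mul_mem_right _ _ hm'
        · rw [map_mul]; exact Ideal.mul_mem_right _ _ (optionEquivLeft_symm_C_mem hker)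

/-- Let `I` be of linear type, `𝔠 = I : a`, and `g ≠ 0` a nonzerodivisor on `R(I) / 𝔠 R(I)`. Then
`I + (a)` is of linear type if it becomes so after inverting `g`. -/
theorem LinearTypeIdeal.sup_span_singleton {I : Ideal A} {a g : A} (hI : LinearTypeIdeal I)
    (hg : g ≠ 0)
    {𝔠 : Ideal A} (h𝔠 : ∀ γ, γ ∈ 𝔠 ↔ γ * a ∈ I)
    (hnzd : ∀ k c, g * c ∈ 𝔠 * I ^ k → c ∈ 𝔠 * I ^ k)
    (hloc : LinearTypeIdeal ((I ⊔ Ideal.span {a}).map (algebraMap A (Localization.Away g)))) :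
    LinearTypeIdeal (I ⊔ Ideal.span {a}) := by
  set f : I → A := Subtype.val with hf
  have hspan : Ideal.span (Set.range f) = I := by simp [f]
  have hspan' : Ideal.span (Set.range (optionFamily f a)) = I ⊔ Ideal.span {a} := by
    rw [span_range_optionFamily, hspan]
  rw [linearTypeIdeal_iff_of_span hspan']
  rw [linearTypeIdeal_iff_of_span
    (f := fun o => algebraMap A (Localization.Away g) (optionFamily f a o))
    (by rw [Set.range_comp' (algebraMap A (Localization.Away g)), ← Ideal.map_span,
      hspan'])] at hloc
  intro F hF
  obtain ⟨N, hN⟩ := LinearTypeFamily.of_localization hg hloc hF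
  have hrel := relImage_partialEval (𝔠 := 𝔠) (fun γ hγ => (h𝔠 γ).2 (by rwa [hspan] at hγ)) hN
  rw [map_mul, partialEval_C] at hrel
  have hnzd' : ∀ N k c, g ^ N * c ∈ 𝔠 * I ^ k → c ∈ 𝔠 * I ^ k := by
    intro N
    induction N with
    | zero => intro k c h; simpa using h
    | succ N ih => intro k c h; exact ih k c (hnzd k _ (by rwa [pow_succ', mul_assoc] at h))
  have := RelImage.mem_linearRelations (a := a) hI (N := N) (g := g) (𝔠 := 𝔠)
    (fun γ hγ => by rw [hspan]; exact (h𝔠 γ).1 hγ)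
    (fun k c => by rw [hspan]; exact hnzd' N k c) hg
    ((optionEquivLeft A I F).natDegree + 1) (optionEquivLeft A I F)
    (Polynomial.degree_le_natDegree.trans_lt (by norm_cast; omega)) hrel
  simpa using this

end OneStep

/-! ### Radical ideals of linear type -/

section RadicalLinearType

variable {A B : Type*} [CommRing A] [CommRing B]

/-- The property carried through the induction. Radicality is needed for linear type: it gives the
colon ideals of the edge binomials. -/
def RadicalLinearType (I : Ideal A) : Prop := I.IsRadical ∧ LinearTypeIdeal I

lemma radicalLinearType_top : RadicalLinearType (⊤ : Ideal A) :=
  ⟨fun _ _ => trivial, linearTypeIdeal_top⟩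

lemma RadicalLinearType.transfer {I : Ideal A} {J : Ideal B} (hJ : RadicalLinearType J)
    (α : A →+* B) (β : B →+* A) (hβα : ∀ a, β (α a) = a) (hα : I.map α ≤ J)
    (hβ : J.map β ≤ I) : RadicalLinearType I := by
  constructor
  · intro a ha
    obtain ⟨n, hn⟩ := ha
    have h1 : α a ∈ J := hJ.1 ⟨n, by rw [← map_pow]; exact hα (Ideal.mem_map_of_mem α hn)⟩
    rw [← hβα a]
    exact hβ (Ideal.mem_map_of_mem β h1)
  · refine LinearTypeFamily.transfer hJ.2 α β hβα (fun i => ?_) fun k => ?_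
    · simpa using hα (Ideal.mem_map_of_mem α i.2)
    · simpa using hβ (Ideal.mem_map_of_mem β k.2)

lemma isRadical_of_localization {I : Ideal A} {g : A} (hg : ∀ c, g * c ∈ I → c ∈ I)
    (h : (I.map (algebraMap A (Localization.Away g))).IsRadical) : I.IsRadical := by
  have hg' : ∀ N c, g ^ N * c ∈ I → c ∈ I := by
    intro N
    induction N with
    | zero => intro c h; simpa using h
    | succ N ih => intro c h; exact ih _ (hg _ (by rwa [pow_succ', mul_assoc] at h))
  rintro c ⟨n, hn⟩
  have h1 : algebraMap A (Localization.Away g) c ∈ I.map (algebraMap A (Localization.Away g)) :=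
    h ⟨n, by rw [← map_pow]; exact Ideal.mem_map_of_mem _ hn⟩
  obtain ⟨_, ⟨N, rfl⟩, hN⟩ :=
    (IsLocalization.algebraMap_mem_map_algebraMap_iff (Submonoid.powers g) _ I c).1 h1
  exact hg' N c hN

end RadicalLinearType

/-! ### Ideals not involving a variable -/

section Stable

variable {σ R : Type*} [CommRing R]

open Classical in
/-- The substitution `X s ↦ 0`. -/
noncomputable def killVar (s : σ) : MvPolynomial σ R →ₐ[R] MvPolynomial σ R :=
  aeval fun t => if t = s then 0 else X t

lemma killVar_X_self (s : σ) : killVar s (X s : MvPolynomial σ R) = 0 := by simp [killVar]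

lemma killVar_X_of_ne {s t : σ} (h : t ≠ s) : killVar s (X t : MvPolynomial σ R) = X t := by
  simp [killVar, h]

lemma X_dvd_sub_killVar (s : σ) (c : MvPolynomial σ R) : X s ∣ c - killVar s c := by
  induction c using MvPolynomial.induction_on with
  | C a => simp [← MvPolynomial.algebraMap_eq]
  | add p q hp hq =>
    rw [map_add, add_sub_add_comm]
    exact dvd_add hp hq
  | mul_X p t hp =>
    by_cases h : t = s
    · subst h; simp [killVar_X_self]
    · rw [map_mul, killVar_X_of_ne h, ← sub_mul]
      exact hp.mul_right _

/-- The quotient `(c - c|_{X s = 0}) / X s`. -/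
noncomputable def divVar (s : σ) (c : MvPolynomial σ R) : MvPolynomial σ R :=
  (X_dvd_sub_killVar s c).choose

lemma X_mul_divVar (s : σ) (c : MvPolynomial σ R) : X s * divVar s c = c - killVar s c :=
  (X_dvd_sub_killVar s c).choose_spec.symm

lemma X_mul_divVar_add (s : σ) (c : MvPolynomial σ R) : X s * divVar s c + killVar s c = c := by
  rw [X_mul_divVar, sub_add_cancel]

/-- The ideal is generated by polynomials not involving the variable `X s`. This is encoded as
stability under `divVar s`, which passes to sums, to products, and to colon ideals by polynomials
not involving `X s`. -/
def VarFree (s : σ) (I : Ideal (MvPolynomial σ R)) : Prop := ∀ c ∈ I, divVar s c ∈ I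

lemma VarFree.killVar_mem {s : σ} {I : Ideal (MvPolynomial σ R)} (hI : VarFree s I)
    {c : MvPolynomial σ R} (hc : c ∈ I) : killVar s c ∈ I := by
  have := X_mul_divVar_add s c
  rw [← eq_sub_iff_add_eq'] at this
  rw [this]
  exact sub_mem hc (Ideal.mul_mem_left _ _ (hI c hc))

lemma varFree_top (s : σ) : VarFree s (⊤ : Ideal (MvPolynomial σ R)) := fun _ _ => trivial

variable [IsDomain R]

lemma divVar_eq_of {s : σ} {c d : MvPolynomial σ R} (h : X s * d = c - killVar s c) :
    divVar s c = d :=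
  mul_left_cancel₀ (X_ne_zero s) ((X_mul_divVar s c).trans h.symm)

lemma divVar_add (s : σ) (c d : MvPolynomial σ R) :
    divVar s (c + d) = divVar s c + divVar s d :=
  divVar_eq_of (by rw [mul_add, X_mul_divVar, X_mul_divVar, map_add]; ring)

/-- The twisted Leibniz rule. -/
lemma divVar_mul (s : σ) (c d : MvPolynomial σ R) :
    divVar s (c * d) = divVar s c * d + killVar s c * divVar s d :=
  divVar_eq_of (by
    rw [mul_add, ← mul_assoc, mul_left_comm, X_mul_divVar, X_mul_divVar, map_mul]; ring)

lemma divVar_X_mul (s : σ) (c : MvPolynomial σ R) : divVar s (X s * c) = c :=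
  divVar_eq_of (by rw [map_mul, killVar_X_self]; ring)

lemma divVar_of_killVar_eq {s : σ} {c : MvPolynomial σ R} (h : killVar s c = c) :
    divVar s c = 0 :=
  divVar_eq_of (by rw [h, mul_zero, sub_self])

lemma divVar_mul_of_killVar_eq {s : σ} (c : MvPolynomial σ R) {d : MvPolynomial σ R}
    (h : killVar s d = d) : divVar s (c * d) = divVar s c * d := by
  rw [divVar_mul, divVar_of_killVar_eq h, mul_zero, add_zero]

lemma exists_iterate_divVar_eq_zero (s : σ) (c : MvPolynomial σ R) :
    ∃ n, ∀ m, n ≤ m → (divVar s)^[m] c = 0 := by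
  have h0 : divVar s (0 : MvPolynomial σ R) = 0 := divVar_of_killVar_eq (map_zero _)
  have hadd : ∀ (n : ℕ) (p q : MvPolynomial σ R),
      (divVar s)^[n] (p + q) = (divVar s)^[n] p + (divVar s)^[n] q := by
    intro n
    induction n with
    | zero => intro p q; rfl
    | succ n ih => intro p q; rw [Function.iterate_succ_apply, divVar_add, ih]; rfl
  have h0' : ∀ n : ℕ, (divVar s)^[n] (0 : MvPolynomial σ R) = 0 := fun n =>
    Function.iterate_fixed h0 n
  induction c using MvPolynomial.induction_on with
  | C a =>
    refine ⟨1, fun m hm => ?_⟩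
    obtain ⟨m, rfl⟩ := Nat.exists_eq_add_of_le' hm
    have : killVar s (C a : MvPolynomial σ R) = C a := (killVar s).commutes a
    rw [Function.iterate_succ_apply, divVar_of_killVar_eq this, h0']
  | add p q hp hq =>
    obtain ⟨n, hn⟩ := hp
    obtain ⟨n', hn'⟩ := hq
    refine ⟨max n n', fun m hm => ?_⟩
    rw [hadd, hn m (le_of_max_le_left hm), hn' m (le_of_max_le_right hm), add_zero]
  | mul_X p t hp =>
    obtain ⟨n, hn⟩ := hp
    by_cases h : t = s
    · refine ⟨n + 1, fun m hm => ?_⟩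
      obtain ⟨m, rfl⟩ := Nat.exists_eq_add_of_le' (Nat.le_of_add_left_le hm)
      rw [Function.iterate_succ_apply, h, mul_comm, divVar_X_mul, hn m (by omega)]
    · refine ⟨n, fun m hm => ?_⟩
      have : ∀ (m : ℕ) (q : MvPolynomial σ R),
          (divVar s)^[m] (q * X t) = (divVar s)^[m] q * X t := by
        intro m
        induction m with
        | zero => intro q; rfl
        | succ m ih =>
          intro q
          rw [Function.iterate_succ_apply, divVar_mul_of_killVar_eq _ (killVar_X_of_ne h), ih]
          rfl
      rw [this, hn m hm, zero_mul]

lemma divVar_induction (s : σ) {P : MvPolynomial σ R → Prop} (h0 : P 0)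
    (h : ∀ c, P (divVar s c) → P c) (c : MvPolynomial σ R) : P c := by
  obtain ⟨n, hn⟩ := exists_iterate_divVar_eq_zero s c
  replace hn := hn n le_rfl
  induction n generalizing c with
  | zero => rw [show c = 0 from hn]; exact h0
  | succ n ih => exact h c (ih _ hn)

namespace VarFree

variable {s : σ} {I J : Ideal (MvPolynomial σ R)}

lemma mem_of_X_mul_mem (hI : VarFree s I) {c : MvPolynomial σ R} (hc : X s * c ∈ I) : c ∈ I := by
  have := hI _ hc
  rwa [divVar_X_mul] at this

lemma sup (hI : VarFree s I) (hJ : VarFree s J) : VarFree s (I ⊔ J) := by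
  intro c hc
  obtain ⟨x, hx, y, hy, rfl⟩ := Submodule.mem_sup.1 hc
  rw [divVar_add]
  exact add_mem (Ideal.mem_sup_left (hI x hx)) (Ideal.mem_sup_right (hJ y hy))

lemma mul (hI : VarFree s I) (hJ : VarFree s J) : VarFree s (I * J) := by
  intro c hc
  refine Submodule.mul_induction_on hc ?_ ?_
  · intro x hx y hy
    rw [divVar_mul]
    exact add_mem (Ideal.mul_mem_mul (hI x hx) hy) (Ideal.mul_mem_mul (hI.killVar_mem hx) (hJ y hy))
  · intro x y hx hy
    rw [divVar_add]
    exact add_mem hx hy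

lemma pow (hI : VarFree s I) (k : ℕ) : VarFree s (I ^ k) := by
  induction k with
  | zero => rw [pow_zero, Ideal.one_eq_top]; exact varFree_top s
  | succ k ih => rw [pow_succ]; exact ih.mul hI

lemma span {T : Set (MvPolynomial σ R)} (hT : ∀ g ∈ T, killVar s g = g) :
    VarFree s (Ideal.span T) := by
  intro c hc
  refine Submodule.span_induction (p := fun c _ => divVar s c ∈ Ideal.span T) ?_ ?_ ?_ ?_ hc
  · intro g hg
    rw [divVar_of_killVar_eq (hT g hg)]; exact zero_mem _
  · rw [divVar_of_killVar_eq (map_zero _)]; exact zero_mem _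
  · intro x y _ _ hx hy
    rw [divVar_add]; exact add_mem hx hy
  · intro b x hx' hx
    rw [smul_eq_mul, divVar_mul]
    exact add_mem (Ideal.mul_mem_left _ _ hx') (Ideal.mul_mem_left _ _ hx)

end VarFree

/-- The colon ideal `I : l`. -/
def colonIdeal {A : Type*} [CommRing A] (I : Ideal A) (l : A) : Ideal A :=
  Submodule.comap (LinearMap.mulRight A l) I

lemma mem_colonIdeal {A : Type*} [CommRing A] {I : Ideal A} {l c : A} :
    c ∈ colonIdeal I l ↔ c * l ∈ I := Iff.rfl

lemma VarFree.colonIdeal {s : σ} {I : Ideal (MvPolynomial σ R)} (hI : VarFree s I)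
    {l : MvPolynomial σ R} (hl : killVar s l = l) : VarFree s (colonIdeal I l) := by
  intro c hc
  rw [mem_colonIdeal, ← divVar_mul_of_killVar_eq c hl]
  exact hI _ hc

lemma linearTypeIdeal_sup_of_varFree {s : σ} {I : Ideal (MvPolynomial σ R)} {a : MvPolynomial σ R}
    (hI : VarFree s I) (hc : VarFree s (BinomialEdge.colonIdeal I a)) (hLT : LinearTypeIdeal I)
    (hloc : LinearTypeIdeal ((I ⊔ Ideal.span {a}).map
      (algebraMap _ (Localization.Away (X s : MvPolynomial σ R))))) :
    LinearTypeIdeal (I ⊔ Ideal.span {a}) :=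
  hLT.sup_span_singleton (X_ne_zero s) (fun _ => mem_colonIdeal)
    (fun k _ h => (hc.mul (hI.pow k)).mem_of_X_mul_mem h) hloc

/-- For linear type, `X s` may be inverted because `I : X s * l = I : l` does not involve it, and
then `X s * l` and `l` generate the same ideal. -/
lemma RadicalLinearType.sup_span_X_mul {s : σ} {I : Ideal (MvPolynomial σ R)} {l : MvPolynomial σ R}
    (hI : VarFree s I) (hl : killVar s l = l) (hgood : RadicalLinearType I)
    (hgood' : RadicalLinearType (I ⊔ Ideal.span {l})) :
    RadicalLinearType (I ⊔ Ideal.span {X s * l}) := by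
  have hle : I ⊔ Ideal.span {X s * l} ≤ I ⊔ Ideal.span {l} :=
    sup_le_sup_left (Ideal.span_singleton_le_span_singleton.2 (Dvd.intro_left _ rfl)) _
  constructor
  · rintro c ⟨n, hn⟩
    have hc0 : killVar s c ∈ I := by
      refine hgood.1 ⟨n, ?_⟩
      obtain ⟨x, hx, y, hy, hxy⟩ := Submodule.mem_sup.1 hn
      obtain ⟨h, rfl⟩ := Ideal.mem_span_singleton.1 hy
      rw [← map_pow, ← hxy, map_add, map_mul, map_mul, killVar_X_self]
      simpa using hI.killVar_mem hx
    have hcl : c ∈ I ⊔ Ideal.span {l} := hgood'.1 ⟨n, hle hn⟩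
    have hD : divVar s c ∈ I ⊔ Ideal.span {l} :=
      hI.sup (VarFree.span (by simpa using hl)) c hcl
    rw [← X_mul_divVar_add s c]
    refine add_mem ?_ (Ideal.mem_sup_left hc0)
    obtain ⟨x, hx, y, hy, hxy⟩ := Submodule.mem_sup.1 hD
    obtain ⟨h, rfl⟩ := Ideal.mem_span_singleton.1 hy
    rw [← hxy, mul_add, ← mul_assoc]
    exact add_mem (Ideal.mem_sup_left (Ideal.mul_mem_left _ _ hx))
      (Ideal.mem_sup_right (Ideal.mul_mem_right _ _ (Ideal.mem_span_singleton_self _)))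
  · refine linearTypeIdeal_sup_of_varFree hI (s := s) ?_ hgood.2 ?_
    · have : BinomialEdge.colonIdeal I (X s * l) = BinomialEdge.colonIdeal I l := by
        ext c
        rw [mem_colonIdeal, mem_colonIdeal, mul_left_comm]
        exact ⟨hI.mem_of_X_mul_mem, Ideal.mul_mem_left _ _⟩
      rw [this]
      exact hI.colonIdeal hl
    · have hu : IsUnit (algebraMap (MvPolynomial σ R)
          (Localization.Away (X s : MvPolynomial σ R)) (X s)) :=
        IsLocalization.Away.algebraMap_isUnit _
      have : (I ⊔ Ideal.span {X s * l}).map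
          (algebraMap _ (Localization.Away (X s : MvPolynomial σ R))) =
          (I ⊔ Ideal.span {l}).map (algebraMap _ (Localization.Away (X s : MvPolynomial σ R))) := by
        rw [Ideal.map_sup, Ideal.map_sup, Ideal.map_span, Ideal.map_span, Set.image_singleton,
          Set.image_singleton, map_mul, Ideal.span_singleton_mul_left_unit hu]
      rw [this]
      exact hgood'.2.map_localization (X_ne_zero s)

lemma RadicalLinearType.sup_span_X {s : σ} {I : Ideal (MvPolynomial σ R)} (hI : VarFree s I)
    (hgood : RadicalLinearType I) :
    RadicalLinearType (I ⊔ Ideal.span {X s}) := by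
  have h1 : I ⊔ Ideal.span {1} = ⊤ := by rw [Ideal.span_singleton_one, sup_top_eq]
  have := RadicalLinearType.sup_span_X_mul hI (map_one _) hgood
    (by rw [h1]; exact radicalLinearType_top)
  rwa [mul_one] at this

end Stable

/-! ### Adding a leaf -/

section Leaf

variable {σ R : Type*} [CommRing R] [IsDomain R]

section

variable {s t : σ} {I : Ideal (MvPolynomial σ R)} {p q : MvPolynomial σ R}

/-! In this section `X s, X t` play the role of the coordinates of a leaf attached to a vertex with
coordinates `p, q`, so that `p * X t - X s * q` is the edge binomial. -/

omit [IsDomain R] in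
lemma killVar_leaf (hst : s ≠ t) (hp : killVar s p = p) :
    killVar s (p * X t - X s * q) = p * X t := by
  rw [map_sub, map_mul, map_mul, hp, killVar_X_self, killVar_X_of_ne hst.symm, zero_mul, sub_zero]

lemma mul_leaf_mem (ht : VarFree t I) (hpq : ∀ c, c * p ∈ I → c * q ∈ I)
    {c : MvPolynomial σ R} (hc : c * (p * X t) ∈ I) : c * (p * X t - X s * q) ∈ I := by
  have h1 : c * p ∈ I := ht.mem_of_X_mul_mem (by convert hc using 1; ring)
  have h2 := hpq c h1
  convert sub_mem (Ideal.mul_mem_left _ (X t) h1) (Ideal.mul_mem_left _ (X s) h2) using 1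
  ring

lemma colonIdeal_leaf (hst : s ≠ t) (hs : VarFree s I) (ht : VarFree t I)
    (hp : killVar s p = p) (hpq : ∀ c, c * p ∈ I → c * q ∈ I) :
    colonIdeal I (p * X t - X s * q) = colonIdeal I p := by
  ext c
  rw [mem_colonIdeal, mem_colonIdeal]
  constructor
  · refine divVar_induction s (P := fun c => c * (p * X t - X s * q) ∈ I → c * p ∈ I)
      (by simp) (fun c ih hc => ?_) c
    have h0 : killVar s c * (p * X t) ∈ I := by
      rw [← killVar_leaf (q := q) hst hp, ← map_mul]; exact hs.killVar_mem hc
    have h1 := mul_leaf_mem (s := s) ht hpq h0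
    have h2 : divVar s c * (p * X t - X s * q) ∈ I := by
      apply hs.mem_of_X_mul_mem
      rw [← mul_assoc, X_mul_divVar, sub_mul]
      exact sub_mem hc h1
    have h3 : killVar s c * p ∈ I := ht.mem_of_X_mul_mem (by convert h0 using 1; ring)
    rw [← X_mul_divVar_add s c, add_mul, mul_assoc]
    exact add_mem (Ideal.mul_mem_left _ _ (ih h2)) h3
  · intro hc
    apply mul_leaf_mem ht hpq
    rw [← mul_assoc]
    exact Ideal.mul_mem_right _ _ hc

lemma mem_sup_leaf_of_X_mul_mem (hst : s ≠ t) (hs : VarFree s I) (ht : VarFree t I)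
    (hp : killVar s p = p) (hpq : ∀ c, c * p ∈ I → c * q ∈ I) {c : MvPolynomial σ R}
    (hc : X s * c ∈ I ⊔ Ideal.span {p * X t - X s * q}) :
    c ∈ I ⊔ Ideal.span {p * X t - X s * q} := by
  set a := p * X t - X s * q with ha
  obtain ⟨x, hx, y, hy, hxy⟩ := Submodule.mem_sup.1 hc
  obtain ⟨h, rfl⟩ := Ideal.mem_span_singleton.1 hy
  have h0 : killVar s h * (p * X t) ∈ I := by
    have h1 := congrArg (killVar s) hxy
    rw [map_add, map_mul, map_mul, killVar_X_self, zero_mul, ha, killVar_leaf hst hp] at h1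
    rw [mul_comm, eq_neg_of_add_eq_zero_right h1]
    exact neg_mem (hs.killVar_mem hx)
  have h1 : killVar s h * a ∈ I := mul_leaf_mem (s := s) ht hpq h0
  have h2 : c - a * divVar s h ∈ I := by
    apply hs.mem_of_X_mul_mem
    have : X s * (c - a * divVar s h) = x + killVar s h * a := by
      have := X_mul_divVar s h
      linear_combination -hxy - a * this
    rw [this]
    exact add_mem hx h1
  rw [← sub_add_cancel c (a * divVar s h)]
  exact add_mem (Ideal.mem_sup_left h2)
    (Ideal.mem_sup_right (Ideal.mul_mem_right _ _ (Ideal.mem_span_singleton_self _)))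

lemma RadicalLinearType.sup_span_leaf (hst : s ≠ t) (hs : VarFree s I) (ht : VarFree t I)
    (hp : killVar s p = p) (hpq : ∀ c, c * p ∈ I → c * q ∈ I) (hI : RadicalLinearType I)
    (hloc : RadicalLinearType ((I ⊔ Ideal.span {p * X t - X s * q}).map
      (algebraMap _ (Localization.Away (X s : MvPolynomial σ R))))) :
    RadicalLinearType (I ⊔ Ideal.span {p * X t - X s * q}) := by
  refine ⟨isRadical_of_localization
    (fun c => mem_sup_leaf_of_X_mul_mem hst hs ht hp hpq) hloc.1, ?_⟩
  refine linearTypeIdeal_sup_of_varFree hs ?_ hI.2 hloc.2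
  rw [colonIdeal_leaf hst hs ht hp hpq]
  exact hs.colonIdeal hp

end

end Leaf

/-! ### The edge ideal of a rooted forest -/

section Forest

variable {V : Type} {R : Type*} [CommRing R]

/-- The edge binomial of the edge joining the vertex `i` to its parent `π i`. -/
noncomputable def forestEdge (R : Type*) [CommRing R] (π : V → V) (i : V) :
    MvPolynomial (V ⊕ V) R :=
  X (Sum.inl (π i)) * X (Sum.inr i) - X (Sum.inl i) * X (Sum.inr (π i))

/-- The ideal generated by the binomials of the edges `{π i, i}` for `i ∈ E`, in the polynomial
ring on all vertices; vertices which lie on no edge do no harm. -/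
noncomputable def forestIdeal (R : Type*) [CommRing R] (π : V → V) (E : Finset V) :
    Ideal (MvPolynomial (V ⊕ V) R) :=
  Ideal.span (forestEdge R π '' E)

variable {π : V → V} {E : Finset V}

lemma forestEdge_mem {i : V} (hi : i ∈ E) : forestEdge R π i ∈ forestIdeal R π E :=
  Ideal.subset_span ⟨i, hi, rfl⟩

lemma map_forestIdeal_le {B : Type*} [CommRing B] (φ : MvPolynomial (V ⊕ V) R →+* B) {J : Ideal B}
    (h : ∀ i ∈ E, φ (forestEdge R π i) ∈ J) : (forestIdeal R π E).map φ ≤ J := by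
  rw [Ideal.map_le_iff_le_comap, forestIdeal, Ideal.span_le]
  rintro _ ⟨i, hi, rfl⟩
  exact h i hi

lemma killVar_forestEdge {s : V ⊕ V} {i j : V} (hs : s = Sum.inl j ∨ s = Sum.inr j) (h1 : i ≠ j)
    (h2 : π i ≠ j) : killVar s (forestEdge R π i) = forestEdge R π i := by
  have h : ∀ k, k ≠ j → Sum.inl k ≠ s ∧ Sum.inr k ≠ s := by
    rintro k hk
    rcases hs with rfl | rfl <;> simp [hk]
  rw [forestEdge, map_sub, map_mul, map_mul, killVar_X_of_ne (h _ h1).1, killVar_X_of_ne (h _ h1).2,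
    killVar_X_of_ne (h _ h2).1, killVar_X_of_ne (h _ h2).2]

lemma forestIdeal_varFree [IsDomain R] {s : V ⊕ V} {j : V} (hs : s = Sum.inl j ∨ s = Sum.inr j)
    (h : ∀ i ∈ E, i ≠ j ∧ π i ≠ j) : VarFree s (forestIdeal R π E) := by
  refine VarFree.span ?_
  rintro _ ⟨i, hi, rfl⟩
  exact killVar_forestEdge hs (h i hi).1 (h i hi).2

lemma forestIdeal_insert [DecidableEq V] (v : V) :
    forestIdeal R π (insert v E) = forestIdeal R π E ⊔ Ideal.span {forestEdge R π v} := by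
  rw [forestIdeal, forestIdeal, Finset.coe_insert, Set.image_insert_eq, Ideal.span_insert, sup_comm]

/-- The one-parameter unipotent substitution `x_i ↦ x_i + t y_i`, `y_i ↦ y_i`, where `t` is
`Polynomial.X`. It fixes all edge binomials. -/
noncomputable def shear (V R : Type*) [CommRing R] :
    MvPolynomial (V ⊕ V) R →+* Polynomial (MvPolynomial (V ⊕ V) R) :=
  eval₂Hom (Polynomial.C.comp C) (Sum.elim
    (fun i => Polynomial.C (X (Sum.inl i)) + Polynomial.X * Polynomial.C (X (Sum.inr i)))
    (fun i => Polynomial.C (X (Sum.inr i))))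

lemma coeff_zero_shear (c : MvPolynomial (V ⊕ V) R) : (shear V R c).coeff 0 = c := by
  have : Polynomial.constantCoeff.comp (shear V R) = RingHom.id _ := by
    apply MvPolynomial.ringHom_ext
    · intro a; simp [shear]
    · rintro (i | i) <;> simp [shear]
  exact RingHom.congr_fun this c

lemma shear_forestEdge (i : V) :
    shear V R (forestEdge R π i) = Polynomial.C (forestEdge R π i) := by
  simp [shear, forestEdge]
  ring

/-- Comparing coefficients of powers of `t` in `shear c * (x_u + t y_u)` gives
`c_{k+1} x_u + c_k y_u ∈ I`. Since `I` is radical, `c_{k+1} y_u ∈ I` implies `c_k y_u ∈ I`, and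
the coefficients `c_k` vanish for large `k`. -/
lemma mul_y_mem_of_mul_x_mem (hrad : (forestIdeal R π E).IsRadical) (u : V)
    (c : MvPolynomial (V ⊕ V) R) (hc : c * X (Sum.inl u) ∈ forestIdeal R π E) :
    c * X (Sum.inr u) ∈ forestIdeal R π E := by
  set I := forestIdeal R π E with hI
  have h1 : shear V R (c * X (Sum.inl u)) ∈ I.map Polynomial.C := by
    have : I.map (shear V R) ≤ I.map Polynomial.C :=
      map_forestIdeal_le _ fun i hi => by
        rw [shear_forestEdge]; exact Ideal.mem_map_of_mem _ (forestEdge_mem hi)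
    exact this (Ideal.mem_map_of_mem _ hc)
  rw [Ideal.mem_map_C_iff, map_mul] at h1
  have h2 : shear V R (X (Sum.inl u)) =
      Polynomial.C (X (Sum.inl u)) + Polynomial.X * Polynomial.C (X (Sum.inr u)) := by
    simp [shear]
  rw [h2] at h1
  set p := shear V R c with hp
  have h3 : ∀ k, p.coeff (k + 1) * X (Sum.inl u) + p.coeff k * X (Sum.inr u) ∈ I := by
    intro k
    have := h1 (k + 1)
    rw [mul_add, Polynomial.coeff_add, Polynomial.coeff_mul_C, ← mul_assoc, Polynomial.coeff_mul_C,
      Polynomial.coeff_mul_X] at this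
    exact this
  have h4 : ∀ m k, p.natDegree < k + m → p.coeff k * X (Sum.inr u) ∈ I := by
    intro m
    induction m with
    | zero =>
      intro k hk
      rw [Polynomial.coeff_eq_zero_of_natDegree_lt (by simpa using hk), zero_mul]
      exact zero_mem _
    | succ m ih =>
      intro k hk
      have h5 := ih (k + 1) (by omega)
      have h6 := sub_mem (Ideal.mul_mem_right (X (Sum.inr u)) _ (h3 k))
        (Ideal.mul_mem_right (X (Sum.inl u)) _ h5)
      refine hrad ⟨2, ?_⟩
      convert Ideal.mul_mem_left _ (p.coeff k) h6 using 1
      ring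
  have := h4 (p.natDegree + 1) 0 (by omega)
  rwa [hp, coeff_zero_shear] at this

end Forest

/-! ### Moving the point of a leaf to `(1, 0)` -/

section CoordinateChange

variable {V : Type} [DecidableEq V] {R : Type*} [CommRing R] {π : V → V} {E : Finset V}

omit [DecidableEq V] in
lemma exists_ringHom {B : Type*} [CommRing B] (φ : R →+* B) (p q : V → B) :
    ∃ α : MvPolynomial (V ⊕ V) R →+* B, (∀ r, α (C r) = φ r) ∧
      (∀ i, α (X (Sum.inl i)) = p i) ∧ ∀ i, α (X (Sum.inr i)) = q i :=
  ⟨eval₂Hom φ (Sum.elim p q), by simp, by simp, by simp⟩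

/-- Specializing the leaf `p_u` to `(1, 0)` turns the binomial of its edge into `-y_w`, where
`w = π u`. The substitution `p_i ↦ (x_i, x_u y_i - y_u x_i)` is a section of this specialization,
with the original point `p_u` kept in the coefficient ring `R[x, y]`. -/
lemma RadicalLinearType.forestIdeal_sup_span_y {u : V} (hu : π u ≠ u)
    (hE : ∀ i ∈ E, i ≠ u ∧ π i ≠ u)
    (h : RadicalLinearType (forestIdeal (MvPolynomial (V ⊕ V) R) π (insert u E))) :
    RadicalLinearType (forestIdeal R π E ⊔ Ideal.span {X (Sum.inr (π u))}) := by
  let S := MvPolynomial (V ⊕ V) R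
  obtain ⟨α, hα, hαx, hαy⟩ := exists_ringHom
    ((C : S →+* MvPolynomial (V ⊕ V) S).comp (C : R →+* S))
    (fun i => if i = u then C (X (Sum.inl u)) else X (Sum.inl i))
    (fun i => if i = u then C (X (Sum.inr u)) else
      X (Sum.inl u) * X (Sum.inr i) - X (Sum.inr u) * X (Sum.inl i))
  obtain ⟨β, hβ, hβx, hβy⟩ := exists_ringHom (RingHom.id S)
    (fun i : V => if i = u then 1 else X (Sum.inl i))
    (fun i => if i = u then 0 else X (Sum.inr i))
  have hβα : β.comp α = RingHom.id S := by
    apply MvPolynomial.ringHom_ext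
    · intro a; simp [hα, hβ]
    · rintro (i | i) <;> by_cases hi : i = u <;> simp [hαx, hαy, hβ, hβx, hβy, hi] <;>
        rfl
  refine h.transfer α β (RingHom.congr_fun hβα) ?_ ?_
  · rw [Ideal.map_sup]
    refine sup_le (map_forestIdeal_le _ fun i hi => ?_) ?_
    · have : α (forestEdge R π i) = X (Sum.inl u) * forestEdge S π i := by
        simp [hαx, hαy, forestEdge, hE i hi]
        ring
      rw [this]
      exact Ideal.mul_mem_left _ _ (forestEdge_mem (Finset.mem_insert_of_mem hi))
    · rw [Ideal.map_span, Set.image_singleton, Ideal.span_singleton_le_iff_mem]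
      have : α (X (Sum.inr (π u))) = -forestEdge S π u := by
        simp [hαy, forestEdge, hu]
        ring
      rw [this]
      exact neg_mem (forestEdge_mem (Finset.mem_insert_self _ _))
  · refine map_forestIdeal_le _ fun i hi => ?_
    rcases Finset.mem_insert.1 hi with rfl | hi
    · have : β (forestEdge S π i) = -X (Sum.inr (π i)) := by
        simp [hβx, hβy, forestEdge, hu]
      rw [this]
      exact neg_mem (Ideal.mem_sup_right (Ideal.mem_span_singleton_self _))
    · have : β (forestEdge S π i) = forestEdge R π i := by
        simp [hβx, hβy, forestEdge, hE i hi]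
      rw [this]
      exact Ideal.mem_sup_left (forestEdge_mem hi)

/-- After inverting `x_v` the matrix with rows `(1/x_v, 0)` and `(-y_v, x_v)` has determinant one
and moves `p_v` to `(1, 0)`. In the new coordinates the binomial of the leaf `v` is `-y_u` with
`u = π v`, and the other binomials are unchanged. -/
lemma RadicalLinearType.map_localization_forestIdeal {v : V} (hv : π v ≠ v)
    (hE : ∀ i ∈ E, i ≠ v ∧ π i ≠ v)
    (h : RadicalLinearType (forestIdeal
      (Localization.Away (X (Sum.inl v) : MvPolynomial (V ⊕ V) R)) π E ⊔
        Ideal.span {X (Sum.inr (π v))})) :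
    RadicalLinearType ((forestIdeal R π (insert v E)).map
      (algebraMap _ (Localization.Away (X (Sum.inl v) : MvPolynomial (V ⊕ V) R)))) := by
  let S := MvPolynomial (V ⊕ V) R
  let L := Localization.Away (X (Sum.inl v) : MvPolynomial (V ⊕ V) R)
  let a : S →+* L := algebraMap S L
  obtain ⟨z, hz⟩ := (IsLocalization.Away.algebraMap_isUnit (S := L)
    (X (Sum.inl v) : MvPolynomial (V ⊕ V) R)).exists_right_inv
  have hz' : a (X (Sum.inl v)) * z = 1 := hz
  have hzC : (C (a (X (Sum.inl v))) * C z : MvPolynomial (V ⊕ V) L) = 1 := by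
    rw [← C_mul, hz', C_1]
  -- `α` expresses the old coordinates by the new ones and `β` the new ones by the old ones; the
  -- coordinates of `v` are kept as constants.
  obtain ⟨α₀, hα₀, hα₀x, hα₀y⟩ := exists_ringHom
    (((C : L →+* MvPolynomial (V ⊕ V) L).comp a).comp (C : R →+* S))
    (fun i => if i = v then C (a (X (Sum.inl v))) else C (a (X (Sum.inl v))) * X (Sum.inl i))
    (fun i => if i = v then C (a (X (Sum.inr v))) else
      C (a (X (Sum.inr v))) * X (Sum.inl i) + C z * X (Sum.inr i))
  have hunit : IsUnit (α₀ (X (Sum.inl v))) := by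
    have : α₀ (X (Sum.inl v)) = C (a (X (Sum.inl v))) := by simp [hα₀x]
    rw [this]
    exact IsUnit.of_mul_eq_one _ hzC
  let α : L →+* MvPolynomial (V ⊕ V) L :=
    IsLocalization.Away.lift (X (Sum.inl v) : MvPolynomial (V ⊕ V) R) hunit
  have hα : ∀ p, α (a p) = α₀ p := fun p => IsLocalization.Away.lift_eq _ hunit p
  obtain ⟨β, hβ, hβx, hβy⟩ := exists_ringHom (RingHom.id L)
    (fun i : V => z * a (X (Sum.inl i)))
    (fun i => a (X (Sum.inl v)) * a (X (Sum.inr i)) - a (X (Sum.inr v)) * a (X (Sum.inl i)))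
  have hβα : β.comp α = RingHom.id L := by
    apply IsLocalization.ringHom_ext (Submonoid.powers (X (Sum.inl v) : MvPolynomial (V ⊕ V) R))
    apply MvPolynomial.ringHom_ext
    · intro r
      show β (α (a (C r))) = a (C r)
      rw [hα]; simp [hα₀, hβ]
    · intro s
      show β (α (a (X s))) = a (X s)
      rw [hα]
      rcases s with i | i
      · by_cases hi : i = v
        · simp [hα₀x, hβ, hi]
        · simp [hα₀x, hβ, hβx, hi]
          linear_combination (a (X (Sum.inl i))) * hz'
      · by_cases hi : i = v
        · simp [hα₀y, hβ, hi]
        · simp [hα₀y, hβ, hβx, hβy, hi]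
          linear_combination (a (X (Sum.inr i))) * hz'
  have hβe : ∀ i, β (forestEdge L π i) = a (forestEdge R π i) := by
    intro i
    simp [hβx, hβy, forestEdge]
    linear_combination (a (X (Sum.inl (π i))) * a (X (Sum.inr i)) -
      a (X (Sum.inl i)) * a (X (Sum.inr (π i)))) * hz'
  refine h.transfer α β (RingHom.congr_fun hβα) ?_ ?_
  · rw [Ideal.map_map]
    refine map_forestIdeal_le _ fun i hi => ?_
    rw [RingHom.comp_apply]
    show α (a _) ∈ _
    rw [hα]
    rcases Finset.mem_insert.1 hi with rfl | hi
    · have : α₀ (forestEdge R π i) = -X (Sum.inr (π i)) := by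
        simp [hα₀x, hα₀y, forestEdge, hv]
        linear_combination (-X (Sum.inr (π i))) * hzC
      rw [this]
      exact neg_mem (Ideal.mem_sup_right (Ideal.mem_span_singleton_self _))
    · have : α₀ (forestEdge R π i) = forestEdge L π i := by
        simp [hα₀x, hα₀y, forestEdge, hE i hi]
        linear_combination (X (Sum.inl (π i)) * X (Sum.inr i) -
          X (Sum.inl i) * X (Sum.inr (π i))) * hzC
      rw [this]
      exact Ideal.mem_sup_left (forestEdge_mem hi)
  · rw [Ideal.map_sup]
    refine sup_le (map_forestIdeal_le _ fun i hi => ?_) ?_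
    · rw [hβe]
      exact Ideal.mem_map_of_mem _ (forestEdge_mem (Finset.mem_insert_of_mem hi))
    · rw [Ideal.map_span, Set.image_singleton, Ideal.span_singleton_le_iff_mem]
      have : β (X (Sum.inr (π v))) = -a (forestEdge R π v) := by
        simp [hβy, forestEdge]
        ring
      rw [this]
      exact neg_mem (Ideal.mem_map_of_mem _ (forestEdge_mem (Finset.mem_insert_self _ _)))

end CoordinateChange

/-! ### Induction on the number of edges -/

section Induction

universe w

variable {V : Type} {π : V → V}

/-- Adding the products `y_i x_u` for vertices `i ∈ T` not involved in `H`. Inverting `y_i`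
replaces the ideal by `I₀ + (x_u)`. -/
lemma RadicalLinearType.sup_span_image {R : Type*} [CommRing R] [IsDomain R]
    {H I₀ : Ideal (MvPolynomial (V ⊕ V) R)} {u : V} (hH : RadicalLinearType H)
    (hle : I₀ ≤ H) (hle' : H ≤ I₀ ⊔ Ideal.span {X (Sum.inl u)})
    (hI₀ : RadicalLinearType (I₀ ⊔ Ideal.span {X (Sum.inl u)})) (T : Finset V)
    (hfree : ∀ i ∈ T, VarFree (Sum.inr i) H) :
    RadicalLinearType
      (H ⊔ Ideal.span ((fun i => X (Sum.inr i) * X (Sum.inl u)) '' (T : Set V))) := by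
  classical
  induction T using Finset.induction_on with
  | empty => simpa using hH
  | insert i T hi ih =>
    have ih := ih fun j hj => hfree j (Finset.mem_insert_of_mem hj)
    rw [Finset.coe_insert, Set.image_insert_eq, Ideal.span_insert, sup_comm (Ideal.span {_}),
      ← sup_assoc]
    refine RadicalLinearType.sup_span_X_mul ?_ (killVar_X_of_ne (by simp)) ih ?_
    · refine (hfree i (Finset.mem_insert_self _ _)).sup (VarFree.span ?_)
      rintro _ ⟨j, hj, rfl⟩
      have hji : j ≠ i := by rintro rfl; exact hi hj
      simp only [map_mul]
      rw [killVar_X_of_ne (by simpa using hji), killVar_X_of_ne (by simp)]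
    · convert hI₀ using 1
      refine le_antisymm (sup_le (sup_le hle' ?_) le_sup_right)
        (sup_le (hle.trans (le_sup_left.trans le_sup_left)) le_sup_right)
      rw [Ideal.span_le]
      rintro _ ⟨j, hj, rfl⟩
      exact Ideal.mul_mem_left _ _ (Ideal.mem_sup_right (Ideal.mem_span_singleton_self _))

/-- The coefficient domain is quantified inside the induction, since the coordinate changes
replace `R` by polynomial rings over `R` and their localizations. -/
theorem radicalLinearType_forestIdeal (d : V → ℕ) (n : ℕ) : ∀ (E : Finset V), E.card = n →
    (∀ i ∈ E, d i = d (π i) + 1) → ∀ (R : Type w) [CommRing R] [IsDomain R],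
    RadicalLinearType (forestIdeal R π E) := by
  classical
  induction n using Nat.strong_induction_on with
  | _ n ih =>
  intro E hn hd R _ _
  rcases E.eq_empty_or_nonempty with rfl | hne
  · have : forestIdeal R π ∅ = ⊥ := by simp [forestIdeal]
    rw [this]
    exact ⟨Ideal.isRadical_bot, linearTypeIdeal_bot⟩
  obtain ⟨v, hvE, hmax⟩ := E.exists_max_image d hne
  subst hn
  obtain ⟨u, hu⟩ : ∃ u, π v = u := ⟨_, rfl⟩
  have hdv : d v = d u + 1 := hu ▸ hd v hvE
  have hvu : v ≠ u := by rintro rfl; omega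
  set E' := E.erase v with hE'
  have hE'v : ∀ i ∈ E', i ≠ v ∧ π i ≠ v := by
    intro i hi
    obtain ⟨h1, h2⟩ := Finset.mem_erase.1 hi
    refine ⟨h1, fun h => ?_⟩
    have := hd i h2
    have := hmax i h2
    rw [h] at *
    omega
  have hd' : ∀ i ∈ E', d i = d (π i) + 1 := fun i hi => hd i (Finset.mem_of_mem_erase hi)
  have hcard : E'.card < E.card := Finset.card_erase_lt_of_mem hvE
  have hgood' : RadicalLinearType (forestIdeal R π E') := ih _ hcard E' rfl hd' R
  -- Inverting `x_v` and moving `p_v` to `(1, 0)` reduces to `J_{E'} + (y_u)`.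
  suffices hmain : ∀ (R : Type w) [CommRing R] [IsDomain R],
      RadicalLinearType (forestIdeal R π E' ⊔ Ideal.span {X (Sum.inr u)}) by
    have hloc := RadicalLinearType.map_localization_forestIdeal (R := R) (π := π) (E := E') (v := v)
      (by rw [hu]; exact hvu.symm) hE'v (by
        have : IsDomain (Localization.Away (X (Sum.inl v) : MvPolynomial (V ⊕ V) R)) :=
          IsLocalization.isDomain_localization
            (powers_le_nonZeroDivisors_of_noZeroDivisors (X_ne_zero _))
        rw [hu]
        exact hmain _)
    rw [← Finset.insert_erase hvE, ← hE']
    rw [forestIdeal_insert] at hloc ⊢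
    unfold forestEdge at hloc ⊢
    rw [hu] at hloc ⊢
    exact RadicalLinearType.sup_span_leaf (by simp) (forestIdeal_varFree (Or.inl rfl) hE'v)
      (forestIdeal_varFree (Or.inr rfl) hE'v) (killVar_X_of_ne (by simpa using hvu.symm))
      (mul_y_mem_of_mul_x_mem hgood'.1 u) hgood' hloc
  clear hgood'
  intro R _ _
  -- The children of `u` other than `v`, and the edges away from `u`.
  set w := π u with hw
  set T := E'.filter (fun i => π i = u) with hT
  set E₀ := E'.filter (fun i => i ≠ u ∧ π i ≠ u) with hE₀
  have hwu : u ∈ E → w ≠ u := by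
    intro h h'
    have := hd u h
    rw [← hw, h'] at this
    omega
  have hE₀u : ∀ i ∈ E₀, i ≠ u ∧ π i ≠ u := fun i hi => (Finset.mem_filter.1 hi).2
  -- Children of `u` are as deep as `v`, hence leaves.
  have hTfacts : ∀ i ∈ T, i ≠ u ∧ ∀ j ∈ E, π j ≠ i := by
    intro i hi
    obtain ⟨h1, h2⟩ := Finset.mem_filter.1 hi
    have h3 := hd' i h1
    rw [h2] at h3
    have hj : ∀ j ∈ E, π j ≠ i := by
      rintro j hj rfl
      have := hd j hj
      have := hmax j hj
      omega
    exact ⟨by rintro rfl; omega, hj⟩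
  have hE₀d : ∀ i ∈ E₀, d i = d (π i) + 1 := fun i hi => hd' i (Finset.mem_filter.1 hi).1
  have hgood₀ : RadicalLinearType (forestIdeal R π E₀) :=
    ih _ ((Finset.card_filter_le _ _).trans_lt hcard) E₀ rfl hE₀d R
  -- The contribution of the edge joining `u` to its parent, if this edge is present.
  set W : Ideal (MvPolynomial (V ⊕ V) R) :=
    Ideal.span {p | u ∈ E ∧ p = X (Sum.inl u) * X (Sum.inr w)} with hW
  have hH : RadicalLinearType (forestIdeal R π E₀ ⊔ W) := by
    by_cases huE : u ∈ E
    · have : W = Ideal.span {X (Sum.inl u) * X (Sum.inr w)} := by simp [hW, huE]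
      rw [this]
      refine RadicalLinearType.sup_span_X_mul (forestIdeal_varFree (Or.inl rfl) hE₀u)
        (killVar_X_of_ne (by simp)) hgood₀ ?_
      refine RadicalLinearType.forestIdeal_sup_span_y (hwu huE) hE₀u (ih _ ?_ _ rfl ?_ _)
      · refine lt_of_le_of_lt (Finset.card_le_card ?_) hcard
        refine Finset.insert_subset (Finset.mem_erase.2 ⟨hvu.symm, huE⟩) (Finset.filter_subset _ _)
      · intro i hi
        rcases Finset.mem_insert.1 hi with rfl | hi
        · exact hd _ huE
        · exact hE₀d i hi
    · have : W = ⊥ := by simp [hW, huE]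
      rw [this, sup_bot_eq]
      exact hgood₀
  have hWle : W ≤ Ideal.span {X (Sum.inl u)} := by
    rw [Ideal.span_le]
    rintro _ ⟨-, rfl⟩
    exact Ideal.mul_mem_right _ _ (Ideal.mem_span_singleton_self _)
  have hW_free : ∀ i, (u ∈ E → w ≠ i) → VarFree (Sum.inr i) W := by
    intro i h
    refine VarFree.span ?_
    rintro _ ⟨huE, rfl⟩
    rw [map_mul, killVar_X_of_ne (by simp), killVar_X_of_ne (by simpa using h huE)]
  have hH2 := RadicalLinearType.sup_span_image (u := u) hH le_sup_left (sup_le_sup_left hWle _)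
    (RadicalLinearType.sup_span_X (forestIdeal_varFree (Or.inl rfl) hE₀u) hgood₀) T (by
      intro i hi
      obtain ⟨h1, h3⟩ := hTfacts i hi
      refine VarFree.sup (forestIdeal_varFree (Or.inr rfl) fun j hj => ⟨?_, ?_⟩)
        (hW_free i fun h => h3 u h)
      · rintro rfl
        exact (hE₀u _ hj).2 (Finset.mem_filter.1 hi).2
      · exact h3 j (Finset.mem_of_mem_erase (Finset.mem_filter.1 hj).1))
  have hedge : ∀ i, π i = u → forestEdge R π i =
      X (Sum.inr i) * X (Sum.inl u) - X (Sum.inl i) * X (Sum.inr u) := by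
    intro i hi
    rw [forestEdge, hi, mul_comm (X (Sum.inl u))]
  have hedge' : forestEdge R π u =
      X (Sum.inl w) * X (Sum.inr u) - X (Sum.inl u) * X (Sum.inr w) := rfl
  have hH3 := RadicalLinearType.sup_span_X (s := Sum.inr u) (VarFree.sup (VarFree.sup
    (forestIdeal_varFree (Or.inr rfl) hE₀u) (hW_free u hwu)) (VarFree.span (by
      rintro _ ⟨i, hi, rfl⟩
      rw [map_mul, killVar_X_of_ne (fun h => (hTfacts i hi).1 (Sum.inr_injective h)),
        killVar_X_of_ne (by simp)])))
    hH2
  convert hH3 using 1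
  set y : Ideal (MvPolynomial (V ⊕ V) R) := Ideal.span {X (Sum.inr u)} with hy
  have hyu : ∀ c, c * X (Sum.inr u) ∈ y := fun c =>
    Ideal.mul_mem_left _ _ (Ideal.mem_span_singleton_self _)
  -- Modulo `y_u` the binomials of the edges at `u` are, up to sign, the products added above.
  have hl : forestIdeal R π E' ≤ forestIdeal R π E' ⊔ y := le_sup_left
  have hr : y ≤ forestIdeal R π E' ⊔ y := le_sup_right
  refine le_antisymm (sup_le ?_ le_sup_right) (sup_le (sup_le (sup_le ?_ ?_) ?_) hr)
  · rw [forestIdeal, Ideal.span_le]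
    rintro _ ⟨i, hi, rfl⟩
    by_cases hiu : i = u
    · subst hiu
      rw [hedge']
      exact sub_mem (Ideal.mem_sup_right (hyu _)) (Ideal.mem_sup_left (Ideal.mem_sup_left
        (Ideal.mem_sup_right (Ideal.subset_span ⟨Finset.mem_of_mem_erase hi, rfl⟩))))
    by_cases hpi : π i = u
    · rw [hedge i hpi]
      exact sub_mem (Ideal.mem_sup_left (Ideal.mem_sup_right
        (Ideal.subset_span ⟨i, Finset.mem_filter.2 ⟨hi, hpi⟩, rfl⟩))) (Ideal.mem_sup_right (hyu _))
    · exact Ideal.mem_sup_left (Ideal.mem_sup_left (Ideal.mem_sup_left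
        (forestEdge_mem (Finset.mem_filter.2 ⟨hi, hiu, hpi⟩))))
  · refine le_trans ?_ le_sup_left
    exact Ideal.span_mono (Set.image_mono (Finset.coe_subset.2 (Finset.filter_subset _ _)))
  · rw [hW, Ideal.span_le]
    rintro _ ⟨huE, rfl⟩
    have h1 := sub_mem (hr (hyu (X (Sum.inl w))))
      (hl (forestEdge_mem (Finset.mem_erase.2 ⟨hvu.symm, huE⟩)))
    rwa [hedge', sub_sub_cancel] at h1
  · rw [Ideal.span_le]
    rintro _ ⟨i, hi, rfl⟩
    obtain ⟨h1, h2⟩ := Finset.mem_filter.1 hi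
    have h3 := add_mem (hl (forestEdge_mem h1)) (hr (hyu (X (Sum.inl i))))
    rwa [hedge i h2, sub_add_cancel] at h3

end Induction

/-! ### Comparison with the symmetric algebra -/

section SymmetricAlgebra

variable {A : Type*} [CommRing A] {I : Ideal A}

/-- The presentation of the symmetric algebra by the polynomial ring on all elements of `I`. -/
noncomputable def toSymmetricAlgebra (I : Ideal A) : MvPolynomial I A →ₐ[A] SymmetricAlgebra A I :=
  aeval (SymmetricAlgebra.ι A I)

lemma toSymmetricAlgebra_surjective : Function.Surjective (toSymmetricAlgebra I) := by
  intro x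
  rw [← AlgHom.mem_range]
  induction x using SymmetricAlgebra.induction with
  | algebraMap r => exact Subalgebra.algebraMap_mem _ r
  | ι x => exact ⟨X x, by simp [toSymmetricAlgebra]⟩
  | mul a b ha hb => exact mul_mem ha hb
  | add a b ha hb => exact add_mem ha hb

lemma toSymmetricAlgebra_eq_zero {F : MvPolynomial I A}
    (hF : F ∈ linearRelations (Subtype.val : I → A)) : toSymmetricAlgebra I F = 0 := by
  have : linearRelations (Subtype.val : I → A) ≤ RingHom.ker (toSymmetricAlgebra I) := by
    refine Ideal.span_le.2 ?_
    rintro _ ⟨c, hc, rfl⟩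
    have hc' : Finsupp.linearCombination A (Subtype.val : I → A) c = 0 := hc
    have h1 : ∀ c : I →₀ A, toSymmetricAlgebra I (Finsupp.linearCombination A X c) =
        SymmetricAlgebra.ι A I (Finsupp.linearCombination A id c) := by
      intro c
      induction c using Finsupp.induction_linear with
      | zero => simp
      | add x y hx hy => simp only [map_add, hx, hy]
      | single i a => simp [toSymmetricAlgebra]
    have h2 : Finsupp.linearCombination A (id : I → I) c = 0 := by
      apply Subtype.val_injective
      show I.subtype _ = _
      rw [Finsupp.apply_linearCombination]
      exact hc'
    show toSymmetricAlgebra I (Finsupp.linearCombination A X c) = 0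
    rw [h1, h2, map_zero]
  exact this hF

lemma coe_symToRees_toSymmetricAlgebra (F : MvPolynomial I A) :
    (symToRees I (toSymmetricAlgebra I F) : Polynomial A) =
      reesEval (Subtype.val : I → A) F := by
  have : ((reesAlgebra I).val.comp (symToRees I)).comp (toSymmetricAlgebra I) =
      reesEval (Subtype.val : I → A) := by
    ext1 i
    simp [toSymmetricAlgebra, symToRees, reesEval, degreeOne]
    rfl
  exact DFunLike.congr_fun this F

theorem LinearTypeIdeal.isOfLinearType (h : LinearTypeIdeal I) : IsOfLinearType I := by
  constructor
  · rw [injective_iff_map_eq_zero]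
    intro x hx
    obtain ⟨F, rfl⟩ := toSymmetricAlgebra_surjective x
    apply toSymmetricAlgebra_eq_zero
    apply h
    rw [← coe_symToRees_toSymmetricAlgebra, hx]
    rfl
  · rintro ⟨y, hy⟩
    have hy' : y ∈ (reesEval (Subtype.val : I → A)).range := by
      rw [range_reesEval]
      simpa using hy
    obtain ⟨F, hF⟩ := hy'
    exact ⟨toSymmetricAlgebra I F, Subtype.ext ((coe_symToRees_toSymmetricAlgebra F).trans hF)⟩

end SymmetricAlgebra

/-! ### Rooting a tree -/

section Tree

variable {V : Type*} {G : SimpleGraph V}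

/-- The parent of `i` is the penultimate vertex of the path from the root `r` to `i`. -/
lemma exists_parent (hG : G.IsTree) (r : V) : ∃ π : V → V,
    (∀ i, i ≠ r → G.Adj (π i) i ∧ G.dist r i = G.dist r (π i) + 1) ∧
    ∀ i j, G.Adj i j → G.dist r i = G.dist r j + 1 → i ≠ r ∧ π i = j := by
  choose P hP hlen using fun i => hG.connected.exists_path_of_dist r i
  refine ⟨fun i => (P i).penultimate, fun i hi => ?_, fun i j hij hd => ⟨?_, ?_⟩⟩
  · have hnil : ¬ (P i).Nil := SimpleGraph.Walk.not_nil_of_ne hi.symm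
    have hadj : G.Adj (P i).penultimate i := (P i).adj_penultimate hnil
    refine ⟨hadj, ?_⟩
    rcases hG.dist_eq_dist_add_one_of_adj r hadj with h | h
    · have h1 := SimpleGraph.dist_le (P i).dropLast
      have h2 : (P i).dropLast.length ≤ (P i).length := by simp
      rw [hlen i] at h2
      omega
    · exact h
  · rintro rfl
    simp at hd
  · have h1 : ((P j).concat hij.symm).length = G.dist r i := by
      rw [SimpleGraph.Walk.length_concat, hlen j, hd]
    have h2 := SimpleGraph.Walk.isPath_of_length_eq_dist _ h1
    have h3 := (hG.existsUnique_path r i).unique h2 (hP i)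
    show (P i).penultimate = j
    rw [← h3, SimpleGraph.Walk.penultimate_concat]

lemma binomialEdgeIdeal_eq_forestIdeal {K : Type*} [Field K] {n : ℕ} {G : SimpleGraph (Fin n)}
    {r : Fin n} {π : Fin n → Fin n} (h1 : ∀ i, i ≠ r → G.Adj (π i) i)
    (h2 : ∀ i j, G.Adj i j → (i ≠ r ∧ π i = j) ∨ (j ≠ r ∧ π j = i)) :
    binomialEdgeIdeal K G = forestIdeal K π (Finset.univ.erase r) := by
  apply le_antisymm
  · rw [binomialEdgeIdeal, Ideal.span_le]
    rintro _ ⟨i, j, -, hij, rfl⟩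
    rcases h2 i j hij with ⟨hi, rfl⟩ | ⟨hj, rfl⟩
    · have : edgeBinomial K i (π i) = -forestEdge K π i := by
        simp only [edgeBinomial, forestEdge]; ring
      rw [this]
      exact neg_mem (forestEdge_mem (by simpa using hi))
    · exact forestEdge_mem (R := K) (π := π) (by simpa using hj)
  · rw [forestIdeal, Ideal.span_le]
    rintro _ ⟨i, hi, rfl⟩
    have hadj := h1 i (by simpa using hi)
    rcases lt_or_gt_of_ne hadj.ne with h | h
    · exact Ideal.subset_span ⟨π i, i, h, hadj, rfl⟩
    · have : forestEdge K π i = -edgeBinomial K i (π i) := by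
        simp only [edgeBinomial, forestEdge]; ring
      rw [this]
      exact neg_mem (Ideal.subset_span ⟨i, π i, h, hadj.symm, rfl⟩)

end Tree

end BinomialEdge

theorem mainTheorem1 {K : Type*} [Field K] {n : ℕ} (G : SimpleGraph (Fin n)) (hG : G.IsTree) :
    BinomialEdge.IsOfLinearType (BinomialEdge.binomialEdgeIdeal K G) := by
  obtain ⟨r⟩ := hG.connected.nonempty
  obtain ⟨π, h1, h2⟩ := BinomialEdge.exists_parent hG r
  rw [BinomialEdge.binomialEdgeIdeal_eq_forestIdeal (r := r) (π := π) (fun i hi => (h1 i hi).1)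
    fun i j hij => (hG.dist_eq_dist_add_one_of_adj r hij).imp (h2 i j hij) (h2 j i hij.symm)]
  exact (BinomialEdge.radicalLinearType_forestIdeal (G.dist r) _ _ rfl
    (fun i hi => (h1 i (Finset.ne_of_mem_erase hi)).2) K).2.isOfLinearType
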